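/- All graphs are finite, simple and nonempty. For a graph $H$ and $k\in\mathbb N$, a set $S_0\subseteq V(H)$ is a $k$-conversion set if $S_t=V(H)$ for some $t\ge 0$, where $S_t$ is obtained from $S_{t-1}$ by adjoining all vertices that have at least $k$ neighbours in $S_{t-1}$; $c_k(H)$ is the least size of a $k$-conversion set. (Every cubic graph $H$ satisfies $c_2(H)\ge\lceil(|V(H)|+2)/4\rceil$.) A graph with maximum degree $\Delta$ is of Class 1 if its chromatic index is $\Delta$, and of Class 2 if its chromatic index is $\Delta+1$. A Gardner snark is a connected, bridgeless, triangle-free cubic graph of Class 2. For cubic graphs $G$ and $A$ and a vertex $a$ of $A$, put $A^-=A-a$. A graph $G\circ A^-$ is any graph obtained by replacing each vertex $v$ of $G$ by a copy $A_v^-$ of $A^-$ and, for each edge $uv$ of $G$, joining a degree-$2$ vertex of $A_u^-$ to a degree-$2$ vertex of $A_v^-$ by an edge, so that each degree-$2$ vertex of each copy is used for exactly one edge (thus $G\circ A^-$ is cubic). **Theorem.** 1. For every $g\ge 3$ and $m\in\mathbb N$ there are cubic graphs $G$ and $A$ and a $3$-connected cubic graph $H=G\circ A^-$ of girth at least $g$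 such that $$c_2(H)-\left\lceil\frac{|V(H)|+2}{4}\right\rceil\ge m.$$ 2. For all cubic graphs $G$ and $A$, every graph $H=G\circ A^-$ is of Class 1 if and only if both $G$ and $A$ are of Class 1. 3. Let $m\in\mathbb N$, let $G$ be a $3$-connected cubic graph of order at least $4m+2$, and let $A$ be a $3$-connected cubic graph of Class 2, of girth at least $4$ and of order divisible by $4$. Then every graph $H=G\circ A^-$ is a Gardner snark with $c_2(H)-\lceil(|V(H)|+2)/4\rceil\ge m$. Moreover, for every $m\in\mathbb N$ there are cubic graphs $G$ and $A$ with $A$ of Class 2, and a $3$-connected Gardner snark $H=G\circ A^-$, such that $c_2(H)-\lceil(|V(H)|+2)/4\rceil\ge m$. -/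

import Mathlib

/-- One round of the irreversible `k`-threshold conversion process: adjoin to `S` every vertex that
has at least `k` neighbours in `S`. -/
def conversionStep {V : Type*} (G : SimpleGraph V) (k : ℕ) (S : Set V) : Set V :=
  S ∪ {v | (k : ℕ∞) ≤ (G.neighborSet v ∩ S).encard}

/-- `S` is a `k`-conversion set: the process started at `S` reaches all vertices at some time. -/
def IsConversionSet {V : Type*} (G : SimpleGraph V) (k : ℕ) (S : Set V) : Prop :=
  ∃ t : ℕ, (conversionStep G k)^[t] S = Set.univ

/-- The `k`-conversion number `c_k(G)` of a finite graph: the least size of a `k`-conversion set. -/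
noncomputable def conversionNumber {V : Type*} [Fintype V] (G : SimpleGraph V) (k : ℕ) : ℕ :=
  sInf {n : ℕ | ∃ S : Finset V, S.card = n ∧ IsConversionSet G k (S : Set V)}

/-- The set of vertices is a `k`-conversion set, so the infimum above is a minimum. -/
theorem conversionNumber_mem {V : Type*} [Fintype V] (G : SimpleGraph V) (k : ℕ) :
    ∃ S : Finset V, S.card = conversionNumber G k ∧ IsConversionSet G k (S : Set V) :=
  Nat.sInf_mem (s := {n : ℕ | ∃ S : Finset V, S.card = n ∧ IsConversionSet G k (S : Set V)})
    ⟨_, Finset.univ, rfl, 0, by simp⟩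

open scoped Classical in
/-- A cubic graph is a `3`-regular graph. -/
def IsCubic {V : Type*} [Fintype V] (G : SimpleGraph V) : Prop :=
  G.IsRegularOfDegree 3

/-- `k`-connectedness: there are more than `k` vertices, and deleting fewer than `k` vertices never
disconnects the graph. -/
def IsVertexConnected {V : Type*} [Fintype V] (G : SimpleGraph V) (k : ℕ) : Prop :=
  k < Fintype.card V ∧ ∀ S : Finset V, S.card < k → (G.induce {v | v ∉ S}).Connected

/-- The chromatic index: the least number of colours in a proper edge colouring. -/
noncomputable def chromaticIndex {V : Type*} (G : SimpleGraph V) : ℕ∞ :=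
  G.lineGraph.chromaticNumber

open scoped Classical in
/-- Class 1: the chromatic index equals the maximum degree. -/
def IsClassOne {V : Type*} [Fintype V] (G : SimpleGraph V) : Prop :=
  chromaticIndex G = (G.maxDegree : ℕ∞)

open scoped Classical in
/-- Class 2: the chromatic index equals the maximum degree plus one. -/
def IsClassTwo {V : Type*} [Fintype V] (G : SimpleGraph V) : Prop :=
  chromaticIndex G = (G.maxDegree : ℕ∞) + 1

/-- A Gardner snark: a connected, bridgeless, triangle-free cubic graph of Class 2. -/
structure IsGardnerSnark {V : Type*} [Fintype V] (G : SimpleGraph V) : Prop where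
  cubic : IsCubic G
  connected : G.Connected
  bridgeless : ∀ e ∈ G.edgeSet, ¬ G.IsBridge e
  triangleFree : G.CliqueFree 3
  classTwo : IsClassTwo G

/-- The graphs `G ∘ A⁻`, where `A⁻ = A - a`. Each vertex `v` of `G` is replaced by the copy
`{v} × (A - a)` of `A - a`, and for each edge `uv` of `G` one edge is added between the copy at `u`
and the copy at `v`. The ends of the added edges are the vertices of the copies that lost a
neighbour, namely the neighbours of `a` in `A`; each of them is used once. The bijections `φ`
record which one is used: the added edge for `uv` joins `φ u v` in the copy at `u` to `φ v u` in
the copy at `v`. The class of all graphs denoted by `G ∘ A⁻` is obtained by letting `a` and `φ`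
vary. -/
def circMinus {V W : Type*} (G : SimpleGraph V) (A : SimpleGraph W) (a : W)
    (φ : ∀ v : V, G.neighborSet v ≃ A.neighborSet a) : SimpleGraph (V × {x : W // x ≠ a}) where
  Adj p q :=
    (p.1 = q.1 ∧ A.Adj p.2 q.2) ∨
      ∃ h : G.Adj p.1 q.1,
        (p.2 : W) = φ p.1 ⟨q.1, h⟩ ∧ (q.2 : W) = φ q.1 ⟨p.1, h.symm⟩
  symm.symm p q := by
    rintro (⟨h1, h2⟩ | ⟨h, h1, h2⟩)
    · exact Or.inl ⟨h1.symm, h2.symm⟩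
    · exact Or.inr ⟨h.symm, h2, h1⟩
  loopless.irrefl p := by
    rintro (⟨_, h⟩ | ⟨h, _⟩)
    · exact A.irrefl h
    · exact G.irrefl h

/-- The amount `c₂(H) - ⌈(|V(H)| + 2) / 4⌉` by which `c₂(H)` exceeds the lower bound. -/
noncomputable def excess {V : Type*} [Fintype V] (H : SimpleGraph V) : ℤ :=
  (conversionNumber H 2 : ℤ) - ⌈((Fintype.card V : ℚ) + 2) / 4⌉

/-! Excess. In a cubic graph the complement of a 2-conversion set spans a forest: the first vertex
of any unconverted set to be converted has at most one neighbour inside that set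
(`IsConversionSet.edgeCount_add_two_le`). Let `A` have order 4k. A copy of `A⁻` has 4k - 1 vertices
and is left by three edges. If n of its vertices lie in the conversion set, counting ordered
adjacent pairs inside the copy gives 12k - 6 ≤ 6n + 2(4k - 1 - n) - 2, so n ≥ k - 1/2 and by
integrality n ≥ k (`IsConversionSet.le_ncard_copy`). The general lower bound grows only by k - 1/4
per copy, so every copy contributes a surplus of 1/4, and 4m + 2 copies give excess m.

Connectivity and girth. For cubic graphs 3-connectedness and 3-edge-connectedness coincide, so only
edge cuts have to be followed. Counting cut edges copy by copy shows that `G ∘ A⁻` inherits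
3-edge-connectedness from `G` and `A`. A cycle that leaves a copy contains a segment in that copy
between two neighbours of `a`, which closes up through `a`; hence the girth is at least that of `A`.

Colouring. A copy has odd order, so each of three colours must occur on an edge leaving it
(`exists_port_color`). The three leaving edges thus have distinct colours, and contracting copies,
or contracting the outside of one copy, colours `G` and `A`. Conversely, colourings of `G` and `A`
are glued after permuting the colours in each copy. That four colours suffice follows from a perfect
matching, provided by Tutte's theorem.

Existence. Large girth comes from a Cayley graph generated by three involutions acting on reduced
words; its 3-edge-connectedness follows from submodularity of cuts. Class 2 comes from the Petersen
graph. Replacing the chosen `A` by K₄ ∘ `A⁻`, of order 4(|A| - 1), makes the order divisible by 4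
and preserves girth bounds and non-colourability. -/

/-! ### Counting edges between two vertex sets -/

/-- The number of ordered pairs `(x, y)` of adjacent vertices with `x ∈ X` and `y ∈ Y`. -/
noncomputable def edgeCount {V : Type*} (G : SimpleGraph V) (X Y : Set V) : ℕ :=
  {p : V × V | p.1 ∈ X ∧ p.2 ∈ Y ∧ G.Adj p.1 p.2}.ncard

/-- Every edge cut has at least three edges. -/
def IsThreeEdgeConnected {V : Type*} (G : SimpleGraph V) : Prop :=
  ∀ X : Set V, X.Nonempty → Xᶜ.Nonempty → 3 ≤ edgeCount G X Xᶜ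

section EdgeCount

variable {V : Type*} {G : SimpleGraph V}

theorem edgeCount_comm (X Y : Set V) : edgeCount G X Y = edgeCount G Y X := by
  have h : {p : V × V | p.1 ∈ X ∧ p.2 ∈ Y ∧ G.Adj p.1 p.2} =
      Prod.swap '' {p : V × V | p.1 ∈ Y ∧ p.2 ∈ X ∧ G.Adj p.1 p.2} := by
    ext ⟨x, y⟩
    simp only [Set.mem_ofPred_eq, Set.mem_image, Prod.exists, Prod.swap_prod_mk, Prod.mk.injEq]
    constructor
    · rintro ⟨hx, hy, h⟩
      exact ⟨y, x, ⟨hy, hx, h.symm⟩, rfl, rfl⟩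
    · rintro ⟨a, b, ⟨ha, hb, h⟩, rfl, rfl⟩
      exact ⟨hb, ha, h.symm⟩
  rw [edgeCount, h, Set.ncard_image_of_injective _ Prod.swap_injective, edgeCount]

theorem edgeCount_singleton_left (x : V) (Y : Set V) :
    edgeCount G {x} Y = (G.neighborSet x ∩ Y).ncard := by
  have h : {p : V × V | p.1 ∈ ({x} : Set V) ∧ p.2 ∈ Y ∧ G.Adj p.1 p.2} =
      Prod.mk x '' (G.neighborSet x ∩ Y) := by
    ext ⟨a, b⟩
    simp only [Set.mem_singleton_iff, Set.mem_ofPred_eq, Set.mem_image, Set.mem_inter_iff,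
      SimpleGraph.mem_neighborSet, Prod.mk.injEq]
    constructor
    · rintro ⟨rfl, hb, h⟩
      exact ⟨b, ⟨h, hb⟩, rfl, rfl⟩
    · rintro ⟨c, ⟨h, hc⟩, rfl, rfl⟩
      exact ⟨rfl, hc, h⟩
  rw [edgeCount, h, Set.ncard_image_of_injective _ (Prod.mk_right_injective x)]

@[simp] theorem edgeCount_empty_left (Y : Set V) : edgeCount G ∅ Y = 0 := by
  simp [edgeCount]

@[simp] theorem edgeCount_empty_right (X : Set V) : edgeCount G X ∅ = 0 := by
  simp [edgeCount]

variable [Finite V]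

theorem edgeCount_mono {X X' Y Y' : Set V} (hX : X ⊆ X') (hY : Y ⊆ Y') :
    edgeCount G X Y ≤ edgeCount G X' Y' :=
  Set.ncard_le_ncard (fun _ hp => ⟨hX hp.1, hY hp.2.1, hp.2.2⟩) (Set.toFinite _)

theorem edgeCount_union_left {X X' : Set V} (Y : Set V) (h : Disjoint X X') :
    edgeCount G (X ∪ X') Y = edgeCount G X Y + edgeCount G X' Y := by
  rw [edgeCount, edgeCount, edgeCount, ← Set.ncard_union_eq _ (Set.toFinite _) (Set.toFinite _)]
  · congr 1
    ext p
    simp only [Set.mem_ofPred_eq, Set.mem_union]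
    tauto
  · rw [Set.disjoint_left] at h ⊢
    exact fun p hp hp' => h hp.1 hp'.1

theorem edgeCount_union_right (X : Set V) {Y Y' : Set V} (h : Disjoint Y Y') :
    edgeCount G X (Y ∪ Y') = edgeCount G X Y + edgeCount G X Y' := by
  rw [edgeCount_comm, edgeCount_union_left _ h, edgeCount_comm Y, edgeCount_comm Y']

theorem edgeCount_split (X Y Z : Set V) :
    edgeCount G X Y = edgeCount G X (Y ∩ Z) + edgeCount G X (Y \ Z) := by
  rw [← edgeCount_union_right _ (Set.disjoint_sdiff_right.mono_left Set.inter_subset_right),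
    Set.inter_union_sdiff]

theorem edgeCount_eq_zero {X Y : Set V} :
    edgeCount G X Y = 0 ↔ ∀ x ∈ X, ∀ y ∈ Y, ¬ G.Adj x y := by
  rw [edgeCount, Set.ncard_eq_zero (Set.toFinite _), Set.eq_empty_iff_forall_notMem]
  simp only [Set.mem_ofPred_eq, Prod.forall, not_and]
  exact ⟨fun h x hx y hy => h x y hx hy, fun h x y hx hy => h x hx y hy⟩

theorem edgeCount_le_of_forall {X Y : Set V} {d : ℕ}
    (h : ∀ x ∈ X, (G.neighborSet x ∩ Y).ncard ≤ d) : edgeCount G X Y ≤ d * X.ncard := by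
  induction X, Set.toFinite X using Set.Finite.induction_on with
  | empty => simp
  | @insert x X hx _ ih =>
    rw [Set.insert_eq, edgeCount_union_left _ (by simpa using hx), edgeCount_singleton_left,
      ← Set.insert_eq, Set.ncard_insert_of_notMem hx]
    have h1 := h x (Set.mem_insert _ _)
    have h2 := ih fun y hy => h y (Set.mem_insert_of_mem _ hy)
    linarith

theorem edgeCount_eq_of_forall {X Y : Set V} {d : ℕ}
    (h : ∀ x ∈ X, (G.neighborSet x ∩ Y).ncard = d) : edgeCount G X Y = d * X.ncard := by
  induction X, Set.toFinite X using Set.Finite.induction_on with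
  | empty => simp
  | @insert x X hx _ ih =>
    rw [Set.insert_eq, edgeCount_union_left _ (by simpa using hx), edgeCount_singleton_left,
      ← Set.insert_eq, Set.ncard_insert_of_notMem hx, h x (Set.mem_insert _ _),
      ih fun y hy => h y (Set.mem_insert_of_mem _ hy)]
    ring

end EdgeCount

/-! ### Cubic graphs and three-connectedness -/

theorem isCubic_iff_ncard {V : Type*} [Fintype V] {G : SimpleGraph V} :
    IsCubic G ↔ ∀ v, (G.neighborSet v).ncard = 3 := by
  classical
  unfold IsCubic SimpleGraph.IsRegularOfDegree
  refine forall_congr' fun v => ?_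
  rw [← SimpleGraph.card_neighborSet_eq_degree, Set.ncard_eq_toFinset_card', Set.toFinset_card]

section Cubic

variable {V : Type*} [Fintype V] {G : SimpleGraph V}

theorem IsCubic.edgeCount_univ (hG : IsCubic G) (X : Set V) :
    edgeCount G X Set.univ = 3 * X.ncard :=
  edgeCount_eq_of_forall fun x _ => by rw [Set.inter_univ]; exact isCubic_iff_ncard.1 hG x

theorem IsCubic.edgeCount_le (hG : IsCubic G) (X Y : Set V) :
    edgeCount G X Y ≤ 3 * X.ncard :=
  hG.edgeCount_univ X ▸ edgeCount_mono le_rfl (Set.subset_univ Y)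

theorem IsCubic.edgeCount_add_compl (hG : IsCubic G) (X Y : Set V) :
    edgeCount G X Y + edgeCount G X Yᶜ = 3 * X.ncard := by
  rw [← hG.edgeCount_univ, ← Set.union_compl_self Y,
    edgeCount_union_right _ disjoint_compl_right]

theorem IsCubic.even_card (hG : IsCubic G) : Even (Fintype.card V) := by
  classical
  have h := G.sum_degrees_eq_twice_card_edges
  rw [Finset.sum_congr rfl fun v _ => hG v, Finset.sum_const, Finset.card_univ,
    smul_eq_mul] at h
  rw [Nat.even_iff]
  omega

theorem IsCubic.four_le_card (hG : IsCubic G) (v : V) : 4 ≤ Fintype.card V := by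
  classical
  have h := G.degree_lt_card_verts v
  rw [hG v] at h
  omega

/-- A small side of an edge cut of a cubic graph has at least three vertices. -/
theorem IsCubic.three_le_ncard (hG : IsCubic G) {X : Set V} (hX : X.Nonempty)
    (h : edgeCount G X Xᶜ ≤ 2) : 3 ≤ X.ncard := by
  have h0 : 0 < X.ncard := (Set.ncard_pos (Set.toFinite _)).2 hX
  have h1 := hG.edgeCount_add_compl X X
  have h2 : edgeCount G X X ≤ (X.ncard - 1) * X.ncard := by
    refine edgeCount_le_of_forall fun x hx => ?_
    rw [← Set.ncard_sdiff_singleton_of_mem hx]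
    exact Set.ncard_le_ncard (fun y hy => ⟨hy.2, fun hyx => G.ne_of_adj hy.1 hyx.symm⟩)
  by_contra! h3
  interval_cases X.ncard <;> omega

theorem IsVertexConnected.isThreeEdgeConnected (hG : IsCubic G) (h : IsVertexConnected G 3) :
    IsThreeEdgeConnected G := by
  classical
  intro X hX hXc
  by_contra! hlt
  have h3 := hG.three_le_ncard hX (by omega)
  -- `B` consists of the ends in `X` of the at most two cut edges. As `X` has at least three
  -- vertices, deleting `B` leaves a vertex of `X` that is cut off from `Xᶜ`.
  set B : Set V := Prod.fst '' {p : V × V | p.1 ∈ X ∧ p.2 ∈ Xᶜ ∧ G.Adj p.1 p.2}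
  have hB : B.ncard ≤ 2 := (Set.ncard_image_le (Set.toFinite _)).trans (Nat.le_of_lt_succ hlt)
  have hc := h.2 B.toFinset (by rw [← Set.ncard_eq_toFinset_card']; omega)
  obtain ⟨x, hx, hxB⟩ : ∃ x ∈ X, x ∉ B := by
    by_contra! hall
    have := Set.ncard_le_ncard (s := X) (t := B) hall
    omega
  obtain ⟨y, hy⟩ := hXc
  have hyB : y ∉ B := by
    rintro ⟨p, hp, rfl⟩
    exact hy hp.1
  obtain ⟨w⟩ := hc.preconnected ⟨x, by simpa using hxB⟩ ⟨y, by simpa using hyB⟩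
  obtain ⟨d, -, hd1, hd2⟩ := w.exists_boundary_dart {z | (z : V) ∈ X} hx hy
  have := d.fst.2
  simp only [Set.mem_toFinset, Set.mem_ofPred_eq] at this
  exact this ⟨(d.fst, d.snd), ⟨hd1, hd2, d.adj⟩, rfl⟩

theorem exists_cut_of_not_connected {W : Type*} [Nonempty W] {H : SimpleGraph W}
    (h : ¬ H.Connected) :
    ∃ X : Set W, X.Nonempty ∧ Xᶜ.Nonempty ∧ ∀ x ∈ X, ∀ y ∈ Xᶜ, ¬ H.Adj x y := by
  have h' : ¬ H.Preconnected := fun hp => h ⟨hp⟩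
  unfold SimpleGraph.Preconnected at h'
  push Not at h'
  obtain ⟨u, v, huv⟩ := h'
  refine ⟨{x | H.Reachable u x}, ⟨u, .rfl⟩, ⟨v, huv⟩, fun x hx y hy hxy => hy ?_⟩
  exact SimpleGraph.Reachable.trans hx hxy.reachable

theorem IsThreeEdgeConnected.connected [Nonempty V] (h : IsThreeEdgeConnected G) :
    G.Connected := by
  by_contra hc
  obtain ⟨X, hX, hXc, hno⟩ := exists_cut_of_not_connected hc
  have := h X hX hXc
  rw [edgeCount_eq_zero.2 hno] at this
  omega

/-- If `S` separates `X` from `Y`, both sides send at least three edges to `S`, so the degrees in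
`S` sum to at least 6. This forces |S| = 2, three edges to each side and no edge within `S`. Each of
the two vertices then has a minority side; moving it there, or exchanging the two, produces a cut
with at most two edges. -/
theorem IsThreeEdgeConnected.isVertexConnected [Nonempty V] (hG : IsCubic G)
    (h : IsThreeEdgeConnected G) : IsVertexConnected G 3 := by
  classical
  have h4 := hG.four_le_card (Classical.arbitrary V)
  refine ⟨by omega, fun S hS => ?_⟩
  by_contra hc
  have hne : Nonempty {v | v ∉ S} := by
    obtain ⟨v, hv⟩ := Finset.exists_mem_notMem_of_card_lt_card
      (s := S) (t := Finset.univ) (by rw [Finset.card_univ]; omega)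
    exact ⟨⟨v, hv.2⟩⟩
  obtain ⟨X', hX', hXc', hno'⟩ := exists_cut_of_not_connected hc
  set X : Set V := (↑) '' X'
  set Y : Set V := (↑) '' X'ᶜ
  have hX : X.Nonempty := hX'.image _
  have hY : Y.Nonempty := hXc'.image _
  have hno : edgeCount G X Y = 0 := by
    rw [edgeCount_eq_zero]
    rintro _ ⟨x, hx, rfl⟩ _ ⟨y, hy, rfl⟩ hxy
    exact hno' x hx y hy hxy
  have hXS : ∀ x ∈ X, x ∉ S := by rintro _ ⟨x, -, rfl⟩; exact x.2
  have hYS : ∀ x ∈ Y, x ∉ S := by rintro _ ⟨x, -, rfl⟩; exact x.2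
  have hXY : Disjoint X Y := by
    rw [Set.disjoint_left]
    rintro _ ⟨x, hx, rfl⟩ ⟨y, hy, hxy⟩
    exact hy (Subtype.ext hxy ▸ hx)
  have hall : ∀ v, v ∈ X ∨ v ∈ Y ∨ v ∈ S := by
    intro v
    by_cases hv : v ∈ S
    · exact .inr (.inr hv)
    · by_cases hv' : (⟨v, hv⟩ : {v | v ∉ S}) ∈ X'
      · exact .inl ⟨_, hv', rfl⟩
      · exact .inr (.inl ⟨_, hv', rfl⟩)
  have hXc : Xᶜ = Y ∪ S := by
    ext v
    have := hall v
    simp only [Set.mem_compl_iff, Set.mem_union, Finset.mem_coe]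
    rw [Set.disjoint_left] at hXY
    have := hXY (a := v)
    have := hXS v
    tauto
  have hYc : Yᶜ = X ∪ S := by
    ext v
    have := hall v
    simp only [Set.mem_compl_iff, Set.mem_union, Finset.mem_coe]
    rw [Set.disjoint_left] at hXY
    have := hXY (a := v)
    have := hYS v
    tauto
  have dYS : Disjoint Y (S : Set V) := Set.disjoint_left.2 hYS
  have dXS : Disjoint X (S : Set V) := Set.disjoint_left.2 hXS
  have cX := h X hX (hXc ▸ hY.mono Set.subset_union_left)
  have cY := h Y hY (hYc ▸ hX.mono Set.subset_union_left)
  rw [hXc, edgeCount_union_right _ dYS, hno, zero_add] at cX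
  rw [hYc, edgeCount_union_right _ dXS, edgeCount_comm, hno, zero_add] at cY
  have huniv : (Set.univ : Set V) = X ∪ (Y ∪ S) := by rw [← hXc, Set.union_compl_self]
  have hdeg : ∀ s : V, edgeCount G {s} X + (edgeCount G {s} Y + edgeCount G {s} S) = 3 := by
    intro s
    have := hG.edgeCount_univ {s}
    rwa [huniv, edgeCount_union_right, edgeCount_union_right _ dYS, Set.ncard_singleton] at this
    rw [← hXc]
    exact disjoint_compl_right
  obtain hS0 | hS1 | hS2 : S.card = 0 ∨ S.card = 1 ∨ S.card = 2 := by omega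
  · rw [Finset.card_eq_zero.1 hS0, Finset.coe_empty, edgeCount_empty_right] at cX
    omega
  · obtain ⟨s, rfl⟩ := Finset.card_eq_one.1 hS1
    have := hdeg s
    rw [Finset.coe_singleton, edgeCount_comm] at cX cY
    omega
  · obtain ⟨s, t, hst, rfl⟩ := Finset.card_eq_two.1 hS2
    have hs := hdeg s
    have ht := hdeg t
    have hsplit : ∀ Z : Set V, edgeCount G Z ({s, t} : Finset V) =
        edgeCount G {s} Z + edgeCount G {t} Z := by
      intro Z
      rw [Finset.coe_pair, Set.insert_eq, edgeCount_union_right _ (by simpa using hst),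
        edgeCount_comm, edgeCount_comm Z]
    have hss : ∀ u : V, edgeCount G {u} {u} = 0 := by
      intro u
      rw [edgeCount_eq_zero]
      rintro _ rfl _ rfl
      exact G.irrefl
    rw [hsplit, hss, zero_add] at hs
    rw [hsplit, hss, add_zero] at ht
    rw [hsplit] at cX cY
    have hsX : s ∉ X := fun hs => hXS s hs (by simp)
    have htX : t ∉ X := fun hs => hXS t hs (by simp)
    have hsY : s ∉ Y := fun hs => hYS s hs (by simp)
    have htY : t ∉ Y := fun hs => hYS t hs (by simp)
    -- The cut around `X ∪ {a}`, where {a, b} is the separator. Applied to both orders of the pair,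
    -- it contradicts the equalities forced by the degrees.
    have key : ∀ a b : V, a ≠ b → a ∉ X → b ∉ X → b ∉ Y → a ∉ Y →
        (({s, t} : Finset V) : Set V) = {a, b} →
        3 ≤ edgeCount G {b} X + edgeCount G {a} Y + edgeCount G {a} {b} := by
      intro a b hab haX hbX hbY haY hSab
      have hc : (X ∪ {a})ᶜ = Y ∪ {b} := by
        rw [Set.compl_union, hXc, hSab]
        ext v
        simp only [Set.mem_inter_iff, Set.mem_union, Set.mem_insert_iff, Set.mem_singleton_iff,
          Set.mem_compl_iff]
        constructor
        · tauto
        · rintro (hv | rfl)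
          · exact ⟨.inl hv, fun hva => haY (hva ▸ hv)⟩
          · exact ⟨.inr (.inr rfl), fun hva => hab hva.symm⟩
      have := h (X ∪ {a}) (hX.mono Set.subset_union_left)
        (hc ▸ hY.mono Set.subset_union_left)
      rw [hc, edgeCount_union_left _ (by simpa using haX),
        edgeCount_union_right _ (by simpa using hbY),
        edgeCount_union_right _ (by simpa using hbY), hno, edgeCount_comm X] at this
      omega
    have k1 := key s t hst hsX htX htY hsY (by simp)
    have k2 := key t s hst.symm htX hsX hsY htY (by simp [Set.pair_comm])
    rw [edgeCount_comm {t} {s}] at hs k2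
    omega

theorem IsThreeEdgeConnected.not_isBridge (h : IsThreeEdgeConnected G) {e : Sym2 V}
    (he : e ∈ G.edgeSet) : ¬ G.IsBridge e := by
  induction e with | h u v => ?_
  rw [SimpleGraph.isBridge_iff]
  intro hb
  have h3 := h {x | (G.deleteEdges {s(u, v)}).Reachable u x} ⟨u, .rfl⟩ ⟨v, hb⟩
  have : edgeCount G {x | (G.deleteEdges {s(u, v)}).Reachable u x}
      {x | (G.deleteEdges {s(u, v)}).Reachable u x}ᶜ ≤ ({(u, v)} : Set (V × V)).ncard := by
    refine Set.ncard_le_ncard ?_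
    rintro ⟨x, y⟩ ⟨hx, hy, hxy⟩
    by_contra hne
    by_cases he' : s(x, y) = s(u, v)
    · rw [Sym2.eq_iff] at he'
      obtain ⟨rfl, rfl⟩ | ⟨rfl, rfl⟩ := he'
      · exact hne rfl
      · exact hb hx
    · refine hy (SimpleGraph.Reachable.trans hx (SimpleGraph.Adj.reachable ?_))
      rw [SimpleGraph.deleteEdges_adj]
      exact ⟨hxy, by simpa using he'⟩
  rw [Set.ncard_singleton] at this
  omega

end Cubic

/-! ### The graphs `G ∘ A⁻`: degrees and edge cuts -/

section CircMinus

variable {V W : Type*} {G : SimpleGraph V} {A : SimpleGraph W} {a : W}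
  {φ : ∀ v : V, G.neighborSet v ≃ A.neighborSet a}

/-- The end in the copy at `v` of the edge of `G ∘ A⁻` that comes from the edge `vu` of `G`. -/
def port (φ : ∀ v : V, G.neighborSet v ≃ A.neighborSet a) {v u : V} (h : G.Adj v u) :
    V × {x : W // x ≠ a} :=
  (v, ⟨φ v ⟨u, h⟩, (A.ne_of_adj (φ v ⟨u, h⟩).2).symm⟩)

theorem circMinus_adj_port {v u : V} (h : G.Adj v u) :
    (circMinus G A a φ).Adj (port φ h) (port φ h.symm) :=
  .inr ⟨h, rfl, rfl⟩

theorem circMinus_adj_inner {v : V} {x y : {x : W // x ≠ a}} :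
    (circMinus G A a φ).Adj (v, x) (v, y) ↔ A.Adj x y := by
  constructor
  · rintro (⟨-, h⟩ | ⟨h, -⟩)
    · exact h
    · exact (G.irrefl h).elim
  · exact fun h => .inl ⟨rfl, h⟩

theorem circMinus_adj_of_fst_eq {p q : V × {x : W // x ≠ a}} (h : p.1 = q.1) :
    (circMinus G A a φ).Adj p q ↔ A.Adj p.2 q.2 := by
  obtain ⟨v, x⟩ := p
  obtain ⟨u, y⟩ := q
  obtain rfl : v = u := h
  exact circMinus_adj_inner

theorem circMinus_adj_of_fst_ne {p q : V × {x : W // x ≠ a}}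
    (h : (circMinus G A a φ).Adj p q) (hne : p.1 ≠ q.1) :
    ∃ h : G.Adj p.1 q.1, p = port φ h ∧ q = port φ h.symm := by
  obtain ⟨h, -⟩ | ⟨h, h1, h2⟩ := h
  · exact (hne h).elim
  · exact ⟨h, Prod.ext rfl (Subtype.ext h1), Prod.ext rfl (Subtype.ext h2)⟩

theorem port_injective {v u u' : V} {h : G.Adj v u} {h' : G.Adj v u'}
    (e : port φ h = port φ h') : u = u' := by
  have h1 : ((φ v ⟨u, h⟩ : A.neighborSet a) : W) = φ v ⟨u', h'⟩ :=
    congrArg (fun p : V × {x : W // x ≠ a} => (p.2 : W)) e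
  exact congrArg Subtype.val ((φ v).injective (Subtype.ext h1))

theorem adj_port (v u : V) (h : G.Adj v u) : A.Adj a (port φ h).2 := (φ v ⟨u, h⟩).2

theorem exists_port {v : V} {x : {x : W // x ≠ a}} (hx : A.Adj a x) :
    ∃ (u : V) (h : G.Adj v u), (v, x) = port φ h := by
  refine ⟨(φ v).symm ⟨x, hx⟩, ((φ v).symm ⟨x, hx⟩).2, ?_⟩
  refine Prod.ext rfl (Subtype.ext ?_)
  simp [port]

/-- Two neighbours outside the copy of a vertex of `G ∘ A⁻` are equal. -/
theorem circMinus_outer_unique {p q r : V × {x : W // x ≠ a}}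
    (hq : (circMinus G A a φ).Adj p q) (hr : (circMinus G A a φ).Adj p r)
    (hpq : p.1 ≠ q.1) (hpr : p.1 ≠ r.1) : q = r := by
  obtain ⟨v, x⟩ := p
  obtain ⟨u, y⟩ := q
  obtain ⟨w, z⟩ := r
  obtain ⟨h1, e1, e1'⟩ := circMinus_adj_of_fst_ne hq hpq
  obtain ⟨h2, e2, e2'⟩ := circMinus_adj_of_fst_ne hr hpr
  dsimp only at h1 h2 e1 e1' e2 e2'
  obtain rfl : u = w := port_injective (e1.symm.trans e2)
  rw [e1', e2']

theorem circMinus_isCubic [Fintype V] [Fintype W] [DecidableEq W] (hA : IsCubic A) :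
    IsCubic (circMinus G A a φ) := by
  classical
  rw [isCubic_iff_ncard] at hA ⊢
  rintro ⟨v, x⟩
  rw [← hA x]
  -- The neighbours of `(v, x)` correspond to those of `x` in `A`: the neighbour outside the copy,
  -- if any, plays the role of `a`.
  refine Set.ncard_congr (fun q _ => if v = q.1 then (q.2 : W) else a) ?_ ?_ ?_
  · intro q hq
    split_ifs with h
    · exact (circMinus_adj_of_fst_eq h).1 hq
    · obtain ⟨h', e, -⟩ := circMinus_adj_of_fst_ne hq h
      have := adj_port (φ := φ) _ _ h'
      rw [← e] at this
      exact this.symm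
  · intro q r hq hr
    split_ifs with h1 h2 h2
    · exact fun e => Prod.ext (h1.symm.trans h2) (Subtype.ext e)
    · exact fun e => (q.2.2 e).elim
    · exact fun e => (r.2.2 e.symm).elim
    · exact fun _ => circMinus_outer_unique hq hr h1 h2
  · intro y hy
    by_cases hya : y = a
    · subst hya
      obtain ⟨u, h, e⟩ := exists_port (φ := φ) (v := v) (x := x) (SimpleGraph.Adj.symm hy)
      refine ⟨port φ h.symm, ?_, if_neg (G.ne_of_adj h)⟩
      rw [e]
      exact circMinus_adj_port h
    · exact ⟨(v, ⟨y, hya⟩), circMinus_adj_inner.2 hy, if_pos rfl⟩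

theorem card_circMinus [Fintype V] [Fintype W] [DecidableEq W] :
    Fintype.card (V × {x : W // x ≠ a}) = Fintype.card V * (Fintype.card W - 1) := by
  rw [Fintype.card_prod, Fintype.card_subtype_compl, Fintype.card_subtype_eq]

/-- The part in the copy at `v` of a set of vertices of `G ∘ A⁻`. -/
def part (U : Set (V × {x : W // x ≠ a})) (v : V) : Set W :=
  {x | ∃ h : x ≠ a, (v, ⟨x, h⟩) ∈ U}

/-- The edges of a cut of `G ∘ A⁻` that come from edges of `G`. -/
def outerCut (φ : ∀ v : V, G.neighborSet v ≃ A.neighborSet a)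
    (U : Set (V × {x : W // x ≠ a})) : Set (V × V) :=
  {e | ∃ h : G.Adj e.1 e.2, port φ h ∈ U ∧ port φ h.symm ∉ U}

variable [Finite V] [Finite W] (U : Set (V × {x : W // x ≠ a}))

theorem edgeCount_part_le (v : V) :
    edgeCount A (part U v) (part Uᶜ v) ≤
      {e : (V × {x : W // x ≠ a}) × (V × {x : W // x ≠ a}) |
        (e.1 ∈ U ∧ e.2 ∈ Uᶜ ∧ (circMinus G A a φ).Adj e.1 e.2) ∧ e.1.1 = v ∧ e.2.1 = v}.ncard := by
  refine le_trans (Set.ncard_le_ncard ?_ (Set.toFinite _))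
    (Set.ncard_image_le (f := fun e => ((e.1.2 : W), (e.2.2 : W))) (Set.toFinite _))
  rintro ⟨x, y⟩ ⟨⟨hx, hxU⟩, ⟨hy, hyU⟩, hxy⟩
  exact ⟨((v, ⟨x, hx⟩), (v, ⟨y, hy⟩)), ⟨⟨hxU, hyU, circMinus_adj_inner.2 hxy⟩, rfl, rfl⟩, rfl⟩

theorem ncard_outerCut_le :
    (outerCut φ U).ncard ≤
      {e : (V × {x : W // x ≠ a}) × (V × {x : W // x ≠ a}) |
        (e.1 ∈ U ∧ e.2 ∈ Uᶜ ∧ (circMinus G A a φ).Adj e.1 e.2) ∧ e.1.1 ≠ e.2.1}.ncard := by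
  refine le_trans (Set.ncard_le_ncard ?_ (Set.toFinite _))
    (Set.ncard_image_le (f := fun e => (e.1.1, e.2.1)) (Set.toFinite _))
  rintro ⟨v, u⟩ ⟨h, h1, h2⟩
  exact ⟨(port φ h, port φ h.symm), ⟨⟨h1, h2, circMinus_adj_port h⟩, G.ne_of_adj h⟩, rfl⟩

theorem edgeCount_part_add_part_le {v v' : V} (hv : v ≠ v') :
    edgeCount A (part U v) (part Uᶜ v) + edgeCount A (part U v') (part Uᶜ v') ≤
      edgeCount (circMinus G A a φ) U Uᶜ := by
  refine (add_le_add (edgeCount_part_le (φ := φ) U v) (edgeCount_part_le (φ := φ) U v')).trans ?_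
  rw [← Set.ncard_union_eq _ (Set.toFinite _) (Set.toFinite _)]
  · refine Set.ncard_le_ncard ?_ (Set.toFinite _)
    rintro e (⟨h, -⟩ | ⟨h, -⟩) <;> exact h
  · rw [Set.disjoint_left]
    rintro e ⟨-, h, -⟩ ⟨-, h', -⟩
    exact hv (h.symm.trans h')

theorem edgeCount_part_add_outerCut_le (v : V) :
    edgeCount A (part U v) (part Uᶜ v) + (outerCut φ U).ncard ≤
      edgeCount (circMinus G A a φ) U Uᶜ := by
  refine (add_le_add (edgeCount_part_le (φ := φ) U v) (ncard_outerCut_le (φ := φ) U)).trans ?_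
  rw [← Set.ncard_union_eq _ (Set.toFinite _) (Set.toFinite _)]
  · refine Set.ncard_le_ncard ?_ (Set.toFinite _)
    rintro e (⟨h, -⟩ | ⟨h, -⟩) <;> exact h
  · rw [Set.disjoint_left]
    rintro e ⟨-, h, h'⟩ ⟨-, h''⟩
    exact h'' (h.trans h'.symm)

end CircMinus

/-- A copy met by both sides of a cut already contains two cut edges. A cut with at most two edges
therefore splits at most one copy. If it splits none, it is a cut of `G`; if it splits the copy at
`v`, no cut edge runs between copies, and the other copies on one side form a cut of `G` with at
most two edges. -/
theorem circMinus_isThreeEdgeConnected {V W : Type*} [Fintype V] [Fintype W]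
    {G : SimpleGraph V} {A : SimpleGraph W} {a : W}
    {φ : ∀ v : V, G.neighborSet v ≃ A.neighborSet a} (hG : IsCubic G) (hA : IsCubic A)
    (hG3 : IsThreeEdgeConnected G) (hA3 : IsThreeEdgeConnected A) :
    IsThreeEdgeConnected (circMinus G A a φ) := by
  classical
  intro U hU hUc
  have hcov : ∀ v, (part U v)ᶜ = part Uᶜ v ∪ {a} := by
    intro v
    ext x
    by_cases hx : x = a <;> simp [part, hx]
  have hcov' : ∀ v, (part Uᶜ v)ᶜ = part U v ∪ {a} := by
    intro v
    ext x
    by_cases hx : x = a <;> simp [part, hx]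
  have haU : ∀ (U : Set (V × {x : W // x ≠ a})) (v : V), a ∉ part U v := fun _ _ h => h.1 rfl
  -- Adding `a` to either side gives two cuts of `A` with at least three edges each. Since `a` has
  -- degree 3, the two inequalities add up to 2e + 3 ≥ 6, so e ≥ 2.
  have hmixed : ∀ v, (part U v).Nonempty → (part Uᶜ v).Nonempty →
      2 ≤ edgeCount A (part U v) (part Uᶜ v) ∧
      (edgeCount A (part U v) (part Uᶜ v) ≤ 2 →
        0 < edgeCount A {a} (part U v) ∧ 0 < edgeCount A {a} (part Uᶜ v)) := by
    intro v h1 h2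
    have e1 := hA3 _ h1 (hcov v ▸ h2.mono Set.subset_union_left)
    have e2 := hA3 _ h2 (hcov' v ▸ h1.mono Set.subset_union_left)
    rw [hcov, edgeCount_union_right _ (by simpa using haU _ v),
      edgeCount_comm _ {a}] at e1
    rw [hcov', edgeCount_union_right _ (by simpa using haU _ v), edgeCount_comm,
      edgeCount_comm _ {a}] at e2
    have e3 : edgeCount A {a} (part U v) + edgeCount A {a} (part Uᶜ v) ≤ 3 := by
      have := hA.edgeCount_add_compl {a} (part U v)
      rw [hcov, edgeCount_union_right _ (by simpa using haU _ v), Set.ncard_singleton] at this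
      omega
    omega
  by_contra! hlt
  by_cases hm : ∃ v, (part U v).Nonempty ∧ (part Uᶜ v).Nonempty
  · obtain ⟨v, h1, h2⟩ := hm
    obtain ⟨hi, ht⟩ := hmixed v h1 h2
    have hO := edgeCount_part_add_outerCut_le (φ := φ) U v
    obtain ⟨t1, t2⟩ := ht (by omega)
    have hO0 : outerCut φ U = ∅ := by
      rw [← Set.ncard_eq_zero (Set.toFinite _)]
      omega
    have hport : ∀ {u w : V} (h : G.Adj u w), port φ h ∈ U → port φ h.symm ∈ U := by
      intro u w h h1
      by_contra h2
      have : (u, w) ∈ outerCut φ U := ⟨h, h1, h2⟩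
      rw [hO0] at this
      exact this
    have hmono : ∀ u, u ≠ v → ∀ {x y}, (u, x) ∈ U → (u, y) ∈ U := by
      intro u hu x y hx
      by_contra hy
      have := (hmixed u ⟨x, x.2, hx⟩ ⟨y, y.2, hy⟩).1
      have := edgeCount_part_add_part_le (φ := φ) U hu
      omega
    have hpos : ∀ (U : Set (V × {x : W // x ≠ a})), 0 < edgeCount A {a} (part U v) →
        ∃ (u : V) (h : G.Adj v u), port φ h ∈ U := by
      intro U h
      rw [edgeCount, Set.ncard_pos (Set.toFinite _)] at h
      obtain ⟨⟨b, x⟩, hb, ⟨hxa, hx⟩, hbx⟩ := h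
      rw [Set.mem_singleton_iff] at hb
      dsimp only at hb hxa hx hbx
      rw [hb] at hbx
      obtain ⟨u, h, e⟩ := exists_port (φ := φ) (v := v) (x := ⟨x, hxa⟩) hbx
      exact ⟨u, h, e ▸ hx⟩
    obtain ⟨u, hu, huU⟩ := hpos _ t1
    obtain ⟨u', hu', huU'⟩ := hpos _ t2
    -- All edges of `G` leaving `X` end at `v`, and one of the three edges at `v` goes to `u'`,
    -- outside `X`.
    set X : Set V := {w | w ≠ v ∧ ∃ x, (w, x) ∈ U}
    have huX : u ∈ X := ⟨(G.ne_of_adj hu).symm, _, hport hu huU⟩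
    have huX' : u' ∉ X := by
      rintro ⟨hne, x, hx⟩
      exact huU' (hport hu'.symm (hmono u' hne hx))
    have h3 := hG3 X ⟨u, huX⟩ ⟨v, fun h => h.1 rfl⟩
    have h4 : edgeCount G X Xᶜ ≤ edgeCount G X {v} := by
      refine Set.ncard_le_ncard ?_ (Set.toFinite _)
      rintro ⟨w, z⟩ ⟨⟨hw, x, hx⟩, hz, hwz⟩
      refine ⟨⟨hw, x, hx⟩, ?_, hwz⟩
      by_contra hzv
      exact hz ⟨hzv, _, hport hwz (hmono w hw hx)⟩
    have h5 := hG.edgeCount_add_compl {v} X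
    have h6 : edgeCount G {v} Xᶜ ≠ 0 := by
      rw [Ne, edgeCount_eq_zero]
      push Not
      exact ⟨v, rfl, u', huX', hu'⟩
    rw [edgeCount_comm X {v}] at h4
    rw [Set.ncard_singleton] at h5
    omega
  · push Not at hm
    have hmono : ∀ u, ∀ {x y}, (u, x) ∈ U → (u, y) ∈ U := by
      intro u x y hx
      by_contra hy
      have := hm u ⟨x, x.2, hx⟩
      exact Set.notMem_empty (y : W) (this ▸ ⟨y.2, hy⟩)
    set X : Set V := {w | ∃ x, (w, x) ∈ U}
    obtain ⟨p, hp⟩ := hU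
    obtain ⟨q, hq⟩ := hUc
    have h3 := hG3 X ⟨p.1, p.2, hp⟩ ⟨q.1, fun ⟨x, hx⟩ => hq (hmono _ hx)⟩
    have h4 : edgeCount G X Xᶜ ≤ (outerCut φ U).ncard := by
      refine Set.ncard_le_ncard ?_ (Set.toFinite _)
      rintro ⟨w, z⟩ ⟨⟨x, hx⟩, hz, hwz⟩
      exact ⟨hwz, hmono w hx, fun h => hz ⟨_, h⟩⟩
    have h5 := edgeCount_part_add_outerCut_le (φ := φ) U p.1
    omega

/-! ### Girth -/

theorem SimpleGraph.egirth_le_of_walk {V : Type*} {G : SimpleGraph V} {x y : V}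
    (h : G.Adj x y) (w : G.Walk y x) (hw : s(x, y) ∉ w.edges) :
    G.egirth ≤ (w.length + 1 : ℕ) := by
  classical
  refine (SimpleGraph.egirth_le_length
    (SimpleGraph.Path.cons_isCycle w.toPath h fun he => hw (w.edges_bypass_subset_edges he))).trans ?_
  rw [SimpleGraph.Walk.length_cons]
  exact_mod_cast Nat.add_le_add_right w.length_bypass_le_length 1

theorem SimpleGraph.Walk.exists_eq_append_cons_of_mem_darts {V : Type*} {G : SimpleGraph V}
    {u v : V} (p : G.Walk u v) {d : G.Dart} (hd : d ∈ p.darts) :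
    ∃ (q : G.Walk u d.fst) (r : G.Walk d.snd v), p = q.append (.cons d.adj r) := by
  induction p with
  | nil => simp at hd
  | cons h p ih =>
    rw [SimpleGraph.Walk.darts_cons, List.mem_cons] at hd
    obtain rfl | hd := hd
    · exact ⟨.nil, p, rfl⟩
    · obtain ⟨q, r, e⟩ := ih hd
      exact ⟨.cons h q, r, by rw [e]; rfl⟩

/-- Removing an edge from a closed trail leaves a walk between the ends of this edge. -/
theorem SimpleGraph.Walk.IsTrail.exists_walk_of_mem_edges {V : Type*} {G : SimpleGraph V}
    {u : V} {p : G.Walk u u} (hp : p.IsTrail) {x y : V} (he : s(x, y) ∈ p.edges) :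
    ∃ w : G.Walk x y, s(x, y) ∉ w.edges ∧ w.length + 1 = p.length ∧ ∀ e ∈ w.edges, e ∈ p.edges := by
  obtain ⟨d, hd, hde⟩ := List.mem_map.1 he
  obtain ⟨q, r, e⟩ := p.exists_eq_append_cons_of_mem_darts hd
  have key : ∃ w : G.Walk d.snd d.fst, s(x, y) ∉ w.edges ∧ w.length + 1 = p.length ∧
      ∀ e ∈ w.edges, e ∈ p.edges := by
    refine ⟨r.append q, ?_, ?_, ?_⟩
    · have := hp.edges_nodup
      rw [e, SimpleGraph.Walk.edges_append, SimpleGraph.Walk.edges_cons, List.nodup_append,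
        List.nodup_cons] at this
      rw [SimpleGraph.Walk.edges_append, List.mem_append, ← hde]
      rintro (h | h)
      · exact this.2.1.1 h
      · exact this.2.2 _ h _ (List.mem_cons_self ..) rfl
    · rw [e]
      simp only [SimpleGraph.Walk.length_append, SimpleGraph.Walk.length_cons]
      omega
    · intro f hf
      rw [e]
      simp only [SimpleGraph.Walk.edges_append, SimpleGraph.Walk.edges_cons, List.mem_append,
        List.mem_cons] at hf ⊢
      tauto
  obtain ⟨w, h1, h2, h3⟩ := key
  obtain ⟨⟨a, b⟩, hab⟩ := d
  rw [SimpleGraph.Dart.edge_mk, Sym2.eq_iff] at hde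
  obtain ⟨rfl, rfl⟩ | ⟨rfl, rfl⟩ := hde
  · exact ⟨w.reverse, by simpa using h1, by simpa using h2, by simpa using h3⟩
  · exact ⟨w, h1, h2, h3⟩

/-- A walk of `G ∘ A⁻` either stays in one copy of `A⁻`, or has an initial part that stays in a
copy and is followed by an edge that leaves this copy. -/
theorem circMinus_walk_cases {V W : Type*} {G : SimpleGraph V} {A : SimpleGraph W} {a : W}
    {φ : ∀ v : V, G.neighborSet v ≃ A.neighborSet a} {p q : V × {x : W // x ≠ a}}
    (w : (circMinus G A a φ).Walk p q) :
    (p.1 = q.1 ∧ ∃ w' : A.Walk p.2 q.2, w'.length = w.length ∧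
      ∀ x y, s(x, y) ∈ w'.edges → ∃ hx hy, s((p.1, ⟨x, hx⟩), (p.1, ⟨y, hy⟩)) ∈ w.edges) ∨
    ∃ (r s : V × {x : W // x ≠ a}) (w' : A.Walk p.2 r.2), r.1 = p.1 ∧ s.1 ≠ r.1 ∧
      (circMinus G A a φ).Adj r s ∧ s(r, s) ∈ w.edges ∧ w'.length + 1 ≤ w.length ∧
      ∀ x y, s(x, y) ∈ w'.edges → ∃ hx hy, s((p.1, ⟨x, hx⟩), (p.1, ⟨y, hy⟩)) ∈ w.edges := by
  induction w with
  | nil => exact .inl ⟨rfl, .nil, rfl, by simp⟩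
  | @cons p p' q h w ih =>
    by_cases hp : p.1 = p'.1
    · have hA := (circMinus_adj_of_fst_eq hp).1 h
      have hlift : ∀ {t : W} (w' : A.Walk p'.2 t), (∀ x y, s(x, y) ∈ w'.edges →
          ∃ hx hy, s((p'.1, ⟨x, hx⟩), (p'.1, ⟨y, hy⟩)) ∈ w.edges) →
          ∀ x y, s(x, y) ∈ (SimpleGraph.Walk.cons hA w').edges →
          ∃ hx hy, s((p.1, ⟨x, hx⟩), (p.1, ⟨y, hy⟩)) ∈ (SimpleGraph.Walk.cons h w).edges := by
        intro t w' hw' x y hxy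
        rw [SimpleGraph.Walk.edges_cons, List.mem_cons] at hxy
        obtain hxy | hxy := hxy
        · rw [Sym2.eq_iff] at hxy
          obtain ⟨rfl, rfl⟩ | ⟨rfl, rfl⟩ := hxy
          · refine ⟨p.2.2, p'.2.2, ?_⟩
            have : p' = (p.1, p'.2) := Prod.ext hp.symm rfl
            rw [SimpleGraph.Walk.edges_cons, List.mem_cons]
            exact .inl (by rw [Sym2.eq_iff]; exact .inl ⟨rfl, this.symm⟩)
          · refine ⟨p'.2.2, p.2.2, ?_⟩
            have : p' = (p.1, p'.2) := Prod.ext hp.symm rfl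
            rw [SimpleGraph.Walk.edges_cons, List.mem_cons]
            exact .inl (by rw [Sym2.eq_iff]; exact .inr ⟨this.symm, rfl⟩)
        · obtain ⟨hx, hy, hm⟩ := hw' x y hxy
          rw [← hp] at hm
          exact ⟨hx, hy, List.mem_cons_of_mem _ hm⟩
      obtain ⟨e, w', hl, hw'⟩ | ⟨r, s, w', hr, hs, hrs, hm, hl, hw'⟩ := ih
      · exact .inl ⟨hp.trans e, .cons hA w', by simp [hl], hlift w' hw'⟩
      · exact .inr ⟨r, s, .cons hA w', hr.trans hp.symm, hs, hrs, List.mem_cons_of_mem _ hm,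
          by simpa using hl, hlift w' hw'⟩
    · exact .inr ⟨p, p', .nil, rfl, fun e => hp e.symm, h, by simp, by simp, by simp⟩

/-- A cycle inside one copy is a cycle of `A`. Otherwise, cut it at an edge `xy` between copies and
follow it from `x` until it first leaves the copy, at `r`. The segment from `x` to `r`, closed by
the path through `a`, yields a cycle of `A` that is no longer. -/
theorem egirth_le_egirth_circMinus {V W : Type*} {G : SimpleGraph V} {A : SimpleGraph W} {a : W}
    {φ : ∀ v : V, G.neighborSet v ≃ A.neighborSet a} :
    A.egirth ≤ (circMinus G A a φ).egirth := by
  rw [SimpleGraph.le_egirth]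
  intro p c hc
  have hadj : ∀ {x y}, s(x, y) ∈ c.edges → (circMinus G A a φ).Adj x y :=
    fun h => c.adj_of_mem_edges h
  by_cases hout : ∃ x y : V × {x : W // x ≠ a}, s(x, y) ∈ c.edges ∧ x.1 ≠ y.1
  · obtain ⟨x, y, he, hne⟩ := hout
    obtain ⟨w, hw1, hw2, -⟩ := hc.isTrail.exists_walk_of_mem_edges he
    obtain ⟨e, -⟩ | ⟨r, s, w', hr, hs, hrs, hm, hl, hw'⟩ := circMinus_walk_cases w
    · exact (hne e).elim
    · have hrx : r ≠ x := by
        rintro rfl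
        exact hw1 (circMinus_outer_unique hrs (hadj he) hs.symm hne ▸ hm)
      obtain ⟨h1, e1, -⟩ := circMinus_adj_of_fst_ne hrs hs.symm
      obtain ⟨h2, e2, -⟩ := circMinus_adj_of_fst_ne (hadj he) hne
      have hra : A.Adj a r.2 := by rw [e1]; exact adj_port _ _ h1
      have hxa : A.Adj a x.2 := by rw [e2]; exact adj_port _ _ h2
      refine (SimpleGraph.egirth_le_of_walk hra.symm (.cons hxa w') ?_).trans ?_
      · rw [SimpleGraph.Walk.edges_cons, List.mem_cons, Sym2.eq_iff]
        rintro ((⟨h, -⟩ | ⟨h, -⟩) | h)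
        · exact r.2.2 h
        · exact hrx (Prod.ext hr (Subtype.ext h))
        · obtain ⟨-, h, -⟩ := hw' _ _ h
          exact h rfl
      · rw [SimpleGraph.Walk.length_cons]
        exact_mod_cast (by omega : w'.length + 1 + 1 ≤ c.length)
  · push Not at hout
    obtain ⟨⟨x, y⟩, he⟩ : ∃ e, e ∈ c.edges := by
      refine List.exists_mem_of_length_pos ?_
      rw [SimpleGraph.Walk.length_edges]
      have := hc.three_le_length
      omega
    change s(x, y) ∈ c.edges at he
    obtain ⟨w, hw1, hw2, hw3⟩ := hc.isTrail.exists_walk_of_mem_edges he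
    have hxy := hout x y he
    obtain ⟨-, w', hl, hw'⟩ | ⟨r, s, w', hr, hs, hrs, hm, -⟩ := circMinus_walk_cases w
    · rw [← hw2, ← hl]
      refine SimpleGraph.egirth_le_of_walk ((circMinus_adj_of_fst_eq hxy).1 (hadj he)).symm w' ?_
      intro h
      rw [Sym2.eq_swap] at h
      obtain ⟨hx, hy, hm⟩ := hw' _ _ h
      have e1 : ((x.1, ⟨x.2, hx⟩) : V × {x : W // x ≠ a}) = x := rfl
      have e2 : ((x.1, ⟨y.2, hy⟩) : V × {x : W // x ≠ a}) = y := Prod.ext hxy rfl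
      rw [e1, e2] at hm
      exact hw1 hm
    · exact (hs (hout r s (hw3 _ hm)).symm).elim

theorem cliqueFree_three_of_four_le_egirth {V : Type*} {G : SimpleGraph V} (h : 4 ≤ G.egirth) :
    G.CliqueFree 3 := by
  classical
  intro s hs
  obtain ⟨u, w, hw, hl⟩ := SimpleGraph.is3Clique_iff_exists_cycle_length_three.1 ⟨s, hs⟩
  have := h.trans (SimpleGraph.egirth_le_length hw)
  rw [hl] at this
  exact absurd this (by decide)

theorem four_le_egirth_of_cliqueFree_three {V : Type*} {G : SimpleGraph V}
    (h : G.CliqueFree 3) : 4 ≤ G.egirth := by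
  classical
  rw [SimpleGraph.le_egirth]
  intro u w hw
  have h3 := hw.three_le_length
  have hne : w.length ≠ 3 := by
    intro h3
    obtain ⟨s, hs⟩ := SimpleGraph.is3Clique_iff_exists_cycle_length_three.2 ⟨u, w, hw, h3⟩
    exact h s hs
  exact_mod_cast (by omega : 4 ≤ w.length)

/-! ### Conversion sets -/

section Conversion

variable {V : Type*} {G : SimpleGraph V} {k : ℕ} {S : Set V}

/-- The first vertex of `K` to be converted has many neighbours outside `K`. -/
theorem IsConversionSet.exists_le_encard (hS : IsConversionSet G k S) {K : Set V}
    (hK : K.Nonempty) (hKS : Disjoint S K) :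
    ∃ v ∈ K, (k : ℕ∞) ≤ (G.neighborSet v ∩ Kᶜ).encard := by
  by_contra! h
  obtain ⟨t, ht⟩ := hS
  have key : ∀ t, Disjoint ((conversionStep G k)^[t] S) K := by
    intro t
    induction t with
    | zero => exact hKS
    | succ t ih =>
      rw [Function.iterate_succ_apply', Set.disjoint_left]
      rintro v (hv | hv) hvK
      · exact Set.disjoint_left.1 ih hv hvK
      · refine absurd ((Set.mem_ofPred_eq ▸ hv : (k : ℕ∞) ≤ _).trans (Set.encard_le_encard ?_))
          (h v hvK).not_ge
        exact Set.inter_subset_inter_right _ (Set.disjoint_left.1 ih)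
  obtain ⟨v, hv⟩ := hK
  exact Set.disjoint_left.1 (key t) (ht ▸ Set.mem_univ v) hv

/-- The complement of a `2`-conversion set of a cubic graph spans a forest. -/
theorem IsConversionSet.edgeCount_add_two_le [Fintype V] (hG : IsCubic G)
    (hS : IsConversionSet G 2 S) {K : Set V} (hK : K.Nonempty) (hKS : Disjoint S K) :
    edgeCount G K K + 2 ≤ 2 * K.ncard := by
  induction hn : K.ncard using Nat.strong_induction_on generalizing K with
  | _ n ih =>
    subst hn
    -- The first vertex of `K` to be converted has at least two of its three neighbours outside `K`.
    -- Deleting it from `K` removes at most one edge.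
    obtain ⟨v, hv, h2⟩ := hS.exists_le_encard hK hKS
    have h2' : 2 ≤ (G.neighborSet v ∩ Kᶜ).ncard := by
      rw [← Set.Finite.cast_ncard_eq (Set.toFinite _)] at h2
      exact_mod_cast h2
    have hd := hG.edgeCount_add_compl {v} K
    rw [edgeCount_singleton_left v Kᶜ, Set.ncard_singleton] at hd
    have hcard := Set.ncard_sdiff_singleton_add_one hv (Set.toFinite K)
    have hdis : Disjoint ({v} : Set V) (K \ {v}) := Set.disjoint_sdiff_right
    have hu : K = {v} ∪ K \ {v} := by simp [Set.insert_eq_of_mem hv]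
    have hvv : edgeCount G {v} {v} = 0 := by
      rw [edgeCount_eq_zero]
      rintro _ rfl _ rfl
      exact G.irrefl
    have e1 : edgeCount G {v} K = edgeCount G {v} (K \ {v}) := by
      rw [hu, edgeCount_union_right _ hdis, hvv, zero_add, ← hu]
    have e2 : edgeCount G K K =
        edgeCount G {v} K + (edgeCount G {v} (K \ {v}) + edgeCount G (K \ {v}) (K \ {v})) := by
      conv_lhs => rw [hu, edgeCount_union_left _ hdis, ← hu]
      rw [edgeCount_comm (K \ {v}) K]
      conv_lhs => enter [2]; rw [hu, edgeCount_union_left _ hdis, ← hu]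
    obtain h0 | hne := (K \ {v}).eq_empty_or_nonempty
    · rw [h0, edgeCount_empty_right] at e1 e2
      rw [h0, Set.ncard_empty] at hcard
      rw [edgeCount_empty_left] at e2
      omega
    · have := ih _ (by omega) hne (hKS.mono_right Set.sdiff_subset) rfl
      omega

end Conversion

/-! ### Lower bound for conversion sets of `G ∘ A⁻`. -/

section Excess

variable {V W : Type*} [Fintype V] [Fintype W] [DecidableEq W] {G : SimpleGraph V}
  {A : SimpleGraph W} {a : W} {φ : ∀ v : V, G.neighborSet v ≃ A.neighborSet a}

/-- A `2`-conversion set of `G ∘ A⁻` has at least `k` vertices in each copy if `A` has order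
`4k`. -/
theorem IsConversionSet.le_ncard_copy (hG : IsCubic G) (hA : IsCubic A) {k : ℕ}
    (hk : Fintype.card W = 4 * k) {S : Set (V × {x : W // x ≠ a})}
    (hS : IsConversionSet (circMinus G A a φ) 2 S) (v : V) :
    k ≤ (S ∩ {p | p.1 = v}).ncard := by
  set H := circMinus G A a φ
  have hH : IsCubic H := circMinus_isCubic hA
  set C : Set (V × {x : W // x ≠ a}) := {p | p.1 = v}
  have hC : C.ncard = 4 * k - 1 := by
    have : C = Prod.mk v '' Set.univ := by
      ext ⟨u, x⟩
      simp [C, eq_comm]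
    rw [this, Set.ncard_image_of_injective _ (Prod.mk_right_injective v), Set.ncard_univ,
      Nat.card_eq_fintype_card, Fintype.card_subtype_compl, Fintype.card_subtype_eq, hk]
  -- Each edge leaving the copy is determined by the neighbour of `v` in `G` to whose copy it leads.
  have hout : edgeCount H C Cᶜ ≤ 3 := by
    rw [← isCubic_iff_ncard.1 hG v]
    refine Set.ncard_le_ncard_of_injOn (fun e => e.2.1) ?_ ?_ (Set.toFinite _)
    · rintro ⟨p, q⟩ ⟨hp, hq, hpq⟩
      change p.1 = v at hp
      obtain ⟨h, -⟩ := circMinus_adj_of_fst_ne hpq fun e => hq (e.symm.trans hp)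
      exact hp ▸ h
    · rintro ⟨p, q⟩ ⟨hp, hq, hpq⟩ ⟨p', q'⟩ ⟨hp', hq', hpq'⟩ (e : q.1 = q'.1)
      obtain ⟨h, e1, e2⟩ := circMinus_adj_of_fst_ne hpq fun e => hq (e.symm.trans hp)
      obtain ⟨h', e1', e2'⟩ := circMinus_adj_of_fst_ne hpq' fun e => hq' (e.symm.trans hp')
      obtain ⟨u, x⟩ := p
      obtain ⟨w, y⟩ := q
      obtain ⟨u', x'⟩ := p'
      obtain ⟨w', y'⟩ := q'
      obtain rfl : u = v := hp
      obtain rfl : u' = u := hp'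
      obtain rfl : w = w' := e
      exact Prod.ext (e1.trans e1'.symm) (e2.trans e2'.symm)
  set T := S ∩ C
  set K := C \ S
  have hTK : Disjoint T K := Set.disjoint_left.2 fun p hp hp' => hp'.2 hp.1
  have hu : C = T ∪ K := by
    ext p
    simp only [T, K, Set.mem_union, Set.mem_inter_iff, Set.mem_sdiff]
    tauto
  have hcard : C.ncard = T.ncard + K.ncard := by
    rw [hu, Set.ncard_union_eq hTK (Set.toFinite _) (Set.toFinite _)]
  obtain hK | hK := K.eq_empty_or_nonempty
  · rw [hK, Set.ncard_empty] at hcard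
    omega
  · have h1 := hS.edgeCount_add_two_le hH hK (Set.disjoint_left.2 fun p hp hp' => hp'.2 hp)
    have h2 := hH.edgeCount_add_compl C C
    have h3 : edgeCount H C C =
        edgeCount H T C + (edgeCount H T K + edgeCount H K K) := by
      conv_lhs => rw [hu, edgeCount_union_left _ hTK, ← hu]
      rw [edgeCount_comm K C]
      conv_lhs => enter [2]; rw [hu, edgeCount_union_left _ hTK]
    have h4 := hH.edgeCount_le T C
    have h5 := hH.edgeCount_le T K
    -- With n = |T|: 12k - 6 ≤ e(C, C) ≤ 3n + 3n + 2(4k - 1 - n) - 2, so 4k - 2 ≤ 4n.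
    omega

/-- Summing over the copies, c₂ is at least |V|k, while the lower bound is ⌈|V|k - (|V| - 2)/4⌉. -/
theorem le_excess_circMinus (hG : IsCubic G) (hA : IsCubic A) (h4 : 4 ∣ Fintype.card W) {m : ℕ}
    (hm : 4 * m + 2 ≤ Fintype.card V) : (m : ℤ) ≤ excess (circMinus G A a φ) := by
  classical
  obtain ⟨k, hk⟩ := h4
  have hk0 : 0 < k := by
    have := hA.four_le_card a
    omega
  obtain ⟨S, hScard, hS⟩ := conversionNumber_mem (circMinus G A a φ) 2
  have hle : Fintype.card V * k ≤ S.card := by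
    rw [Finset.card_eq_sum_card_fiberwise (f := Prod.fst) (t := Finset.univ) (by simp),
      ← smul_eq_mul, ← Finset.card_univ]
    refine Finset.card_nsmul_le_sum _ _ _ fun v _ => ?_
    refine (hS.le_ncard_copy hG hA hk v).trans_eq ?_
    rw [← Set.ncard_coe_finset]
    congr 1
    ext p
    simp
  rw [hScard] at hle
  unfold excess
  have hceil : ⌈((Fintype.card (V × {x : W // x ≠ a}) : ℚ) + 2) / 4⌉ ≤
      (Fintype.card V : ℤ) * k - m := by
    rw [Int.ceil_le, card_circMinus, hk, Nat.cast_mul, Nat.cast_sub (by omega)]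
    push_cast
    have : (4 * m + 2 : ℚ) ≤ Fintype.card V := by exact_mod_cast hm
    linarith
  have : (Fintype.card V : ℤ) * k ≤ conversionNumber (circMinus G A a φ) 2 := by
    exact_mod_cast hle
  linarith

end Excess

/-! ### Edge colourings -/

/-- `G` has a proper edge colouring with `n` colours, given as a symmetric function. -/
def EdgeColorable {V : Type*} (G : SimpleGraph V) (n : ℕ) : Prop :=
  ∃ c : V → V → Fin n, (∀ x y, c x y = c y x) ∧
    ∀ v x y, G.Adj v x → G.Adj v y → c v x = c v y → x = y

/-- Values on nonadjacent pairs are irrelevant but must exist; `NeZero n` supplies the default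
colour 0 for them. -/
theorem edgeColorable_iff {V : Type*} {G : SimpleGraph V} {n : ℕ} [NeZero n] :
    EdgeColorable G n ↔ G.lineGraph.Colorable n := by
  classical
  constructor
  · rintro ⟨c, hs, hc⟩
    refine ⟨SimpleGraph.Coloring.mk (fun e => Sym2.lift ⟨c, hs⟩ e.1) ?_⟩
    rintro ⟨e, he⟩ ⟨f, hf⟩ hef heq
    rw [SimpleGraph.lineGraph_adj_iff_exists] at hef
    obtain ⟨hne, v, hve, hvf⟩ := hef
    obtain ⟨x, rfl⟩ := Sym2.mem_iff_exists.1 hve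
    obtain ⟨y, rfl⟩ := Sym2.mem_iff_exists.1 hvf
    simp only [Sym2.lift_mk] at heq
    obtain rfl := hc v x y he hf heq
    exact hne rfl
  · rintro ⟨c⟩
    refine ⟨fun x y => if h : s(x, y) ∈ G.edgeSet then c ⟨s(x, y), h⟩ else 0, ?_, ?_⟩
    · intro x y
      simp only [Sym2.eq_swap (a := x)]
    · intro v x y hx hy heq
      have hx' : s(v, x) ∈ G.edgeSet := hx
      have hy' : s(v, y) ∈ G.edgeSet := hy
      simp only [hx', hy', dif_pos] at heq
      by_contra hne
      refine c.valid (v := ⟨s(v, x), hx'⟩) (w := ⟨s(v, y), hy'⟩) ?_ heq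
      rw [SimpleGraph.lineGraph_adj_iff_exists]
      exact ⟨fun h => hne (Sym2.congr_right.1 (congrArg Subtype.val h)), v,
        Sym2.mem_mk_left _ _, Sym2.mem_mk_left _ _⟩

theorem EdgeColorable.of_iso {V V' : Type*} {G : SimpleGraph V} {G' : SimpleGraph V'} {n : ℕ}
    (f : G ≃g G') (h : EdgeColorable G' n) : EdgeColorable G n := by
  obtain ⟨c, hs, hc⟩ := h
  exact ⟨fun x y => c (f x) (f y), fun x y => hs _ _, fun v x y hx hy e =>
    f.injective (hc _ _ _ (f.map_adj_iff.2 hx) (f.map_adj_iff.2 hy) e)⟩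

section Cubic

variable {V : Type*} [Fintype V] {G : SimpleGraph V}

theorem IsCubic.maxDegree_eq [Nonempty V] [DecidableRel G.Adj] (hG : IsCubic G) :
    G.maxDegree = 3 := by
  have h : G.IsRegularOfDegree 3 := by
    intro v
    rw [← hG v]
    congr!
  exact h.maxDegree_eq

theorem IsCubic.three_le_of_edgeColorable [Nonempty V] (hG : IsCubic G) {n : ℕ}
    (h : EdgeColorable G n) : 3 ≤ n := by
  obtain ⟨c, -, hc⟩ := h
  have v := Classical.arbitrary V
  rw [← isCubic_iff_ncard.1 hG v, ← Nat.card_fin n, ← Set.ncard_univ]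
  exact Set.ncard_le_ncard_of_injOn (c v) (fun _ _ => Set.mem_univ _)
    (fun x hx y hy e => hc v x y hx hy e) (Set.toFinite _)

theorem IsCubic.le_chromaticIndex [Nonempty V] (hG : IsCubic G) :
    3 ≤ chromaticIndex G := by
  have : ((3 : ℕ) : ℕ∞) ≤ G.lineGraph.chromaticNumber := by
    rw [SimpleGraph.le_chromaticNumber_iff_colorable]
    intro n hn
    have : NeZero (n + 1) := ⟨by omega⟩
    rcases n with _ | n
    · have v := Classical.arbitrary V
      obtain ⟨u, hu⟩ : (G.neighborSet v).Nonempty := by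
        rw [← Set.ncard_pos (Set.toFinite _), isCubic_iff_ncard.1 hG v]
        norm_num
      exact (hn.some ⟨s(v, u), hu⟩).elim0
    · exact hG.three_le_of_edgeColorable (edgeColorable_iff.2 hn)
  exact this

theorem IsCubic.isClassOne_iff [Nonempty V] (hG : IsCubic G) :
    IsClassOne G ↔ EdgeColorable G 3 := by
  classical
  rw [IsClassOne, hG.maxDegree_eq, edgeColorable_iff,
    ← SimpleGraph.chromaticNumber_le_iff_colorable]
  exact ⟨fun h => h.le, fun h => le_antisymm h hG.le_chromaticIndex⟩

theorem IsCubic.not_edgeColorable_of_isClassTwo [Nonempty V] (hG : IsCubic G)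
    (h : IsClassTwo G) : ¬ EdgeColorable G 3 := by
  classical
  rw [IsClassTwo, hG.maxDegree_eq] at h
  rw [edgeColorable_iff, ← SimpleGraph.chromaticNumber_le_iff_colorable]
  change ¬ (chromaticIndex G ≤ _)
  rw [h]
  decide

theorem IsCubic.isClassTwo_of_edgeColorable [Nonempty V] (hG : IsCubic G)
    (h3 : ¬ EdgeColorable G 3) (h4 : EdgeColorable G 4) : IsClassTwo G := by
  classical
  rw [IsClassTwo, hG.maxDegree_eq]
  rw [edgeColorable_iff, ← SimpleGraph.chromaticNumber_le_iff_colorable] at h3 h4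
  refine le_antisymm h4 ?_
  exact Order.add_one_le_of_lt (not_le.1 h3)

end Cubic

section CircMinus

variable {V W : Type*} {G : SimpleGraph V} {A : SimpleGraph W}
  {a : W} {φ : ∀ v : V, G.neighborSet v ≃ A.neighborSet a}

/-- The parity lemma: in a proper `3`-edge colouring of `G ∘ A⁻`, every colour occurs on an edge
that leaves a given copy of `A⁻`. -/
theorem exists_port_color [Fintype V] [Fintype W] [DecidableEq W] (hA : IsCubic A)
    {c : V × {x : W // x ≠ a} → V × {x : W // x ≠ a} → Fin 3} (hs : ∀ p q, c p q = c q p)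
    (hc : ∀ p q r, (circMinus G A a φ).Adj p q → (circMinus G A a φ).Adj p r →
      c p q = c p r → q = r) (v : V) (i : Fin 3) :
    ∃ (u : V) (h : G.Adj v u), c (port φ h) (port φ h.symm) = i := by
  classical
  set H := circMinus G A a φ
  have hH : IsCubic H := circMinus_isCubic hA
  have hex : ∀ p, ∃ q, H.Adj p q ∧ c p q = i := by
    intro p
    -- Three neighbours with distinct colours exhaust the palette, so each vertex has a partner of
    -- colour `i`.
    have himg : c p '' H.neighborSet p = Set.univ := by
      refine Set.eq_of_subset_of_ncard_le (Set.subset_univ _) ?_ (Set.toFinite _)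
      have hinj : Set.InjOn (c p) (H.neighborSet p) := fun q hq r hr e => hc p q r hq hr e
      rw [hinj.ncard_image, isCubic_iff_ncard.1 hH, Set.ncard_univ, Nat.card_fin]
    obtain ⟨q, hq, e⟩ := himg.ge (Set.mem_univ i)
    exact ⟨q, hq, e⟩
  choose f hf hfi using hex
  have hff : ∀ p, f (f p) = p := fun p =>
    hc _ _ _ (hf _) (hf p).symm ((hfi _).trans ((hs _ _).trans (hfi p)).symm)
  by_contra! hno
  have hin : ∀ x, (f (v, x)).1 = v := by
    intro x
    by_contra hne
    obtain ⟨h, e1, e2⟩ := circMinus_adj_of_fst_ne (hf (v, x)) fun e => hne e.symm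
    exact hno _ h (by rw [← e1, ← e2, hfi])
  let g : {x : W // x ≠ a} → {x : W // x ≠ a} := fun x => (f (v, x)).2
  have hg : ∀ x, (v, g x) = f (v, x) := fun x => Prod.ext (hin x).symm rfl
  have hinv : Function.Involutive g := by
    intro x
    change (f (v, g x)).2 = x
    rw [hg, hff]
  have hodd : ¬ 2 ∣ Fintype.card {x : W // x ≠ a} := by
    rw [Fintype.card_subtype_compl, Fintype.card_subtype_eq]
    have := hA.even_card
    have := hA.four_le_card a
    rw [Nat.even_iff] at *
    omega
  have : Fact (Nat.Prime 2) := ⟨Nat.prime_two⟩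
  -- If colour `i` never leaves the copy, its edges match the copy within itself; but an involution
  -- of a set of odd order has a fixed point.
  obtain ⟨x, hx⟩ := Equiv.Perm.exists_fixed_point_of_prime (p := 2) (n := 1)
    (σ := hinv.toPerm) hodd (by ext x; simp [pow_two, hinv x])
  have hx' : g x = x := hx
  have := hf (v, x)
  rw [← hg, hx'] at this
  exact H.irrefl this

/-- By the parity lemma the three edges leaving a copy have three distinct colours. Contracting all
copies gives a colouring of `G`; contracting everything outside one copy to `a` gives one of `A`. -/
theorem EdgeColorable.of_circMinus [Fintype V] [Nonempty V] [Fintype W] [DecidableEq W]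
    (hG : IsCubic G) (hA : IsCubic A) (h : EdgeColorable (circMinus G A a φ) 3) : EdgeColorable G 3 ∧ EdgeColorable A 3 := by
  classical
  obtain ⟨c, hs, hc⟩ := h
  have hinj : ∀ v : V, ∀ x y : G.neighborSet v,
      c (port φ x.2) (port φ x.2.symm) = c (port φ y.2) (port φ y.2.symm) → x = y := by
    intro v
    have hsurj : Function.Surjective
        fun x : G.neighborSet v => c (port φ x.2) (port φ x.2.symm) := by
      intro i
      obtain ⟨u, h, e⟩ := exists_port_color hA hs hc v i
      exact ⟨⟨u, h⟩, e⟩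
    have hcard : Fintype.card (G.neighborSet v) = Fintype.card (Fin 3) := by
      rw [← Nat.card_eq_fintype_card, Nat.card_coe_set_eq, isCubic_iff_ncard.1 hG v,
        Fintype.card_fin]
    exact ((Fintype.bijective_iff_surjective_and_card _).2 ⟨hsurj, hcard⟩).1
  constructor
  · refine ⟨fun x y => if h : G.Adj x y then c (port φ h) (port φ h.symm) else 0, ?_, ?_⟩
    · intro x y
      by_cases h : G.Adj x y
      · simp only [dif_pos h, dif_pos h.symm, hs (port φ h)]
      · have h' : ¬ G.Adj y x := fun h' => h h'.symm
        simp only [dif_neg h, dif_neg h']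
    · intro v x y hx hy e
      simp only [dif_pos hx, dif_pos hy] at e
      exact congrArg Subtype.val (hinj v ⟨x, hx⟩ ⟨y, hy⟩ e)
  · have v := Classical.arbitrary V
    let o : W → Fin 3 := fun y => if h : A.Adj a y then
      c (port φ ((φ v).symm ⟨y, h⟩).2) (port φ (SimpleGraph.Adj.symm ((φ v).symm ⟨y, h⟩).2)) else 0
    let d : W → W → Fin 3 := fun x y => if hx : x = a then o y else if hy : y = a then o x else
      c (v, ⟨x, hx⟩) (v, ⟨y, hy⟩)
    have hda : ∀ y, d a y = o y := fun y => dif_pos rfl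
    have hdx : ∀ x (hx : x ≠ a), d x a = o x := fun x hx => by simp [d, hx]
    have hdxy : ∀ x y (hx : x ≠ a) (hy : y ≠ a), d x y = c (v, ⟨x, hx⟩) (v, ⟨y, hy⟩) :=
      fun x y hx hy => by simp [d, hx, hy]
    have hout : ∀ x (hx : x ≠ a), A.Adj a x → ∃ q, (circMinus G A a φ).Adj (v, ⟨x, hx⟩) q ∧
        q.1 ≠ v ∧ o x = c (v, ⟨x, hx⟩) q := by
      intro x hx hax
      have h : G.Adj v ((φ v).symm ⟨x, hax⟩) := ((φ v).symm ⟨x, hax⟩).2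
      have e : port φ h = (v, ⟨x, hx⟩) :=
        Prod.ext rfl <| Subtype.ext <|
          show ((φ v ((φ v).symm ⟨x, hax⟩) : A.neighborSet a) : W) = x by
            rw [Equiv.apply_symm_apply]
      refine ⟨port φ h.symm, e ▸ circMinus_adj_port h, (G.ne_of_adj h).symm, ?_⟩
      rw [← e]
      exact dif_pos hax
    refine ⟨d, ?_, ?_⟩
    · intro x y
      by_cases hx : x = a
      · subst hx
        by_cases hy : y = x
        · rw [hy]
        · rw [hda, hdx y hy]
      · by_cases hy : y = a
        · subst hy
          rw [hda, hdx x hx]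
        · rw [hdxy x y hx hy, hdxy y x hy hx, hs]
    · intro x y z hy hz e
      by_cases hx : x = a
      · subst hx
        rw [hda, hda] at e
        simp only [o, dif_pos hy, dif_pos hz] at e
        exact congrArg Subtype.val ((φ v).symm.injective (hinj v _ _ e))
      · by_cases hya : y = a
        · by_cases hza : z = a
          · rw [hya, hza]
          · subst hya
            obtain ⟨q, hq, hqv, eq⟩ := hout x hx hy.symm
            rw [hdx x hx, eq, hdxy x z hx hza] at e
            exact (hqv (congrArg Prod.fst (hc _ _ _ hq (circMinus_adj_inner.2 hz) e))).elim
        · by_cases hza : z = a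
          · subst hza
            obtain ⟨q, hq, hqv, eq⟩ := hout x hx hz.symm
            rw [hdx x hx, eq, hdxy x y hx hya] at e
            exact (hqv (congrArg Prod.fst (hc _ _ _ hq (circMinus_adj_inner.2 hy) e.symm))).elim
          · rw [hdxy x y hx hya, hdxy x z hx hza] at e
            have := hc _ _ _ (circMinus_adj_inner.2 hy) (circMinus_adj_inner.2 hz) e
            exact congrArg (fun p : V × {x : W // x ≠ a} => (p.2 : W)) this

/-- At each `v`, a permutation of the colours makes the colouring of `A` at `a` agree with that of
`G` at `v`, so the copies fit together along the edges of `G`. -/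
theorem edgeColorable_circMinus [Fintype V] (hG : IsCubic G)
    (h1 : EdgeColorable G 3) (h2 : EdgeColorable A 3) : EdgeColorable (circMinus G A a φ) 3 := by
  classical
  obtain ⟨c, hs, hc⟩ := h1
  obtain ⟨d, hds, hd⟩ := h2
  have hperm : ∀ v, ∃ σ : Equiv.Perm (Fin 3), ∀ x : G.neighborSet v, σ (d a (φ v x)) = c v x := by
    intro v
    have hcard : Fintype.card (G.neighborSet v) = Fintype.card (Fin 3) := by
      rw [← Nat.card_eq_fintype_card, Nat.card_coe_set_eq, isCubic_iff_ncard.1 hG v,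
        Fintype.card_fin]
    have b1 := (Fintype.bijective_iff_injective_and_card fun x : G.neighborSet v => c v x).2
      ⟨fun x y e => Subtype.ext (hc v x y x.2 y.2 e), hcard⟩
    have b2 := (Fintype.bijective_iff_injective_and_card
      fun x : G.neighborSet v => d a (φ v x)).2
      ⟨fun x y e => (φ v).injective (Subtype.ext (hd a _ _ (φ v x).2 (φ v y).2 e)), hcard⟩
    refine ⟨(Equiv.ofBijective _ b2).symm.trans (Equiv.ofBijective _ b1), fun x => ?_⟩
    have : (Equiv.ofBijective _ b2).symm (d a (φ v x)) = x :=
      (Equiv.ofBijective _ b2).symm_apply_apply x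
    rw [Equiv.trans_apply, this]
    rfl
  choose σ hσ using hperm
  refine ⟨fun p q => if p.1 = q.1 then σ p.1 (d p.2 q.2) else c p.1 q.1, ?_, ?_⟩
  · intro p q
    by_cases h : p.1 = q.1
    · simp only [h, if_true, hds (p.2 : W)]
    · simp only [if_neg h, if_neg (Ne.symm h), hs p.1]
  · have hmix : ∀ p q r, (circMinus G A a φ).Adj p q →
        (circMinus G A a φ).Adj p r →
        p.1 = q.1 → p.1 ≠ r.1 → σ p.1 (d p.2 q.2) ≠ c p.1 r.1 := by
      intro p q r hq hr h1 h2 e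
      obtain ⟨h, e1, -⟩ := circMinus_adj_of_fst_ne hr h2
      have e2 := hσ p.1 ⟨r.1, h⟩
      have e3 : ((φ p.1 ⟨r.1, h⟩ : A.neighborSet a) : W) = p.2 := by
        conv_rhs => rw [e1]
        rfl
      rw [e3] at e2
      have e4 := (σ p.1).injective (e.trans e2.symm)
      rw [hds a] at e4
      refine q.2.2 (hd p.2 q.2 a ((circMinus_adj_of_fst_eq h1).1 hq) ?_ e4)
      rw [e1]
      exact (adj_port _ _ h).symm
    intro p q r hq hr e
    by_cases h1 : p.1 = q.1 <;> by_cases h2 : p.1 = r.1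
    · simp only [if_pos h1, if_pos h2] at e
      exact Prod.ext (h1.symm.trans h2) (Subtype.ext (hd p.2 q.2 r.2
        ((circMinus_adj_of_fst_eq h1).1 hq) ((circMinus_adj_of_fst_eq h2).1 hr)
        ((σ p.1).injective e)))
    · simp only [if_pos h1, if_neg h2] at e
      exact (hmix p q r hq hr h1 h2 e).elim
    · simp only [if_neg h1, if_pos h2] at e
      exact (hmix p r q hr hq h2 h1 e.symm).elim
    · exact circMinus_outer_unique hq hr h1 h2

end CircMinus

/-! ### Four colours suffice for the edges of a three-edge-connected cubic graph -/

/-- Greedy colouring. -/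
theorem colorable_of_ncard_neighborSet_le {E : Type*} [Finite E] {L : SimpleGraph E} {d : ℕ}
    (h : ∀ e, (L.neighborSet e).ncard ≤ d) : L.Colorable (d + 1) := by
  classical
  have key : ∀ s : Set E, ∃ c : E → Fin (d + 1), ∀ x ∈ s, ∀ y ∈ s, L.Adj x y → c x ≠ c y := by
    intro s
    induction s, Set.toFinite s using Set.Finite.induction_on with
    | empty => exact ⟨fun _ => 0, by simp⟩
    | @insert x s hx _ ih =>
      obtain ⟨c, hc⟩ := ih
      obtain ⟨i, hi⟩ : ∃ i, i ∉ c '' L.neighborSet x := by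
        by_contra! hall
        have h1 := Set.ncard_le_ncard (s := Set.univ) (fun i _ => hall i)
        rw [Set.ncard_univ, Nat.card_fin] at h1
        have h2 := Set.ncard_image_le (f := c) (Set.toFinite (L.neighborSet x))
        have := h x
        omega
      have hi' : ∀ y, L.Adj x y → i ≠ c y := fun y hy e => hi ⟨y, hy, e.symm⟩
      refine ⟨Function.update c x i, fun y hy z hz hyz => ?_⟩
      by_cases hyx : y = x
      · subst hyx
        rw [Function.update_self, Function.update_of_ne (L.ne_of_adj hyz).symm]
        exact hi' z hyz
      · by_cases hzx : z = x
        · subst hzx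
          rw [Function.update_self, Function.update_of_ne hyx]
          exact (hi' y hyz.symm).symm
        · rw [Function.update_of_ne hyx, Function.update_of_ne hzx]
          exact hc y (hy.resolve_left hyx) z (hz.resolve_left hzx) hyz
  obtain ⟨c, hc⟩ := key Set.univ
  exact ⟨SimpleGraph.Coloring.mk c fun h => hc _ trivial _ trivial h⟩

/-- Each end of an edge lies on at most one further edge, so the line graph has maximum degree at
most 2 and greedy colouring applies. -/
theorem edgeColorable_three_of_ncard_le_two {V : Type*} [Finite V] {G : SimpleGraph V}
    (h : ∀ v, (G.neighborSet v).ncard ≤ 2) : EdgeColorable G 3 := by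
  rw [edgeColorable_iff]
  refine colorable_of_ncard_neighborSet_le (d := 2) ?_
  rintro ⟨e, he⟩
  induction e with | h u v => ?_
  have hone : ∀ x y, G.Adj x y → ((fun w => s(x, w)) '' (G.neighborSet x \ {y})).ncard ≤ 1 := by
    intro x y hxy
    refine (Set.ncard_image_le (Set.toFinite _)).trans ?_
    rw [Set.ncard_sdiff_singleton_of_mem (show y ∈ G.neighborSet x from hxy)]
    have := h x
    omega
  rw [← Set.ncard_image_of_injective _ Subtype.val_injective]
  refine (Set.ncard_le_ncard (t := (fun w => s(u, w)) '' (G.neighborSet u \ {v}) ∪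
    (fun w => s(v, w)) '' (G.neighborSet v \ {u})) ?_ (Set.toFinite _)).trans
    ((Set.ncard_union_le _ _).trans (add_le_add (hone u v he) (hone v u (G.symm.symm _ _ he))))
  rintro _ ⟨⟨f, hf⟩, hef, rfl⟩
  rw [SimpleGraph.mem_neighborSet, SimpleGraph.lineGraph_adj_iff_exists] at hef
  obtain ⟨hne, x, hx, hxf⟩ := hef
  obtain ⟨w, rfl⟩ := Sym2.mem_iff_exists.1 hxf
  obtain rfl | rfl := Sym2.mem_iff.1 hx
  · exact .inl ⟨w, ⟨hf, fun e => hne (Subtype.ext (congrArg (s(x, ·)) e.symm))⟩, rfl⟩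
  · exact .inr ⟨w, ⟨hf, fun e => hne (Subtype.ext
      (Sym2.eq_swap.trans (congrArg (s(x, ·)) e.symm)))⟩, rfl⟩

section Matching

variable {V : Type*} [Fintype V] {G : SimpleGraph V}

/-- Every odd component of the graph without `u` sends at least three edges to `u`, and `u` receives
at most 3|u| edges. So there are at most |u| odd components, as Tutte's condition requires. -/
theorem IsThreeEdgeConnected.exists_isPerfectMatching (hG : IsCubic G)
    (h3 : IsThreeEdgeConnected G) : ∃ M : G.Subgraph, M.IsPerfectMatching := by
  rw [SimpleGraph.tutte]
  intro u hu
  unfold SimpleGraph.IsTutteViolator at hu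
  set K := ((⊤ : G.Subgraph).deleteVerts u).coe
  let f : K.ConnectedComponent → Set V := fun C => (↑) '' C.supp
  have hfu : ∀ C, ∀ x ∈ f C, x ∉ u := by
    rintro C _ ⟨x, -, rfl⟩
    exact x.2.2
  have hdisj : ∀ C D, ∀ x, x ∈ f C → x ∈ f D → C = D := by
    rintro C D _ ⟨x, hx, rfl⟩ ⟨y, hy, e⟩
    obtain rfl : y = x := Subtype.ext e
    exact hx.symm.trans hy
  have hodd : ∀ C ∈ K.oddComponents, 3 ≤ edgeCount G u (f C) := by
    intro C hC
    have hne : (f C).Nonempty := C.nonempty_supp.image _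
    have hcard : (f C).ncard = C.supp.ncard :=
      Set.ncard_image_of_injective _ Subtype.val_injective
    -- An odd component is not everything, because a cubic graph has even order.
    have hcne : (f C)ᶜ.Nonempty := by
      rw [Set.nonempty_compl]
      intro e
      rw [e, Set.ncard_univ, Nat.card_eq_fintype_card] at hcard
      have hC' : Odd C.supp.ncard := hC
      rw [← hcard] at hC'
      exact Nat.not_even_iff_odd.2 hC' hG.even_card
    refine (h3 _ hne hcne).trans ?_
    rw [edgeCount_comm u]
    refine Set.ncard_le_ncard ?_ (Set.toFinite _)
    rintro ⟨x, y⟩ ⟨hx, hy, hxy⟩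
    refine ⟨hx, ?_, hxy⟩
    by_contra hyu
    obtain ⟨x, hxC, rfl⟩ := hx
    refine hy ⟨⟨y, trivial, hyu⟩, ?_, rfl⟩
    rw [SimpleGraph.ConnectedComponent.mem_supp_iff] at hxC ⊢
    rw [← hxC, SimpleGraph.ConnectedComponent.eq]
    refine SimpleGraph.Adj.reachable ?_
    change ((⊤ : G.Subgraph).deleteVerts u).Adj y x
    rw [SimpleGraph.Subgraph.deleteVerts_adj]
    exact ⟨trivial, hyu, trivial, x.2.2, hxy.symm⟩
  have hsum : ∀ 𝒞 : Set K.ConnectedComponent, 𝒞 ⊆ K.oddComponents →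
      3 * 𝒞.ncard ≤ edgeCount G u (⋃ C ∈ 𝒞, f C) := by
    intro 𝒞
    induction 𝒞, Set.toFinite 𝒞 using Set.Finite.induction_on with
    | empty => simp
    | @insert C 𝒞 hC _ ih =>
      intro hsub
      rw [Set.ncard_insert_of_notMem hC, Set.biUnion_insert, edgeCount_union_right]
      · have h1 := hodd C (hsub (Set.mem_insert _ _))
        have h2 := ih ((Set.subset_insert _ _).trans hsub)
        omega
      · rw [Set.disjoint_left]
        intro x hx hx'
        obtain ⟨D, hD, hxD⟩ := Set.mem_iUnion₂.1 hx'
        exact hC (hdisj C D x hx hxD ▸ hD)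
  have h1 := hsum _ le_rfl
  have h2 := hG.edgeCount_le u (⋃ C ∈ K.oddComponents, f C)
  omega

/-- A perfect matching takes the fourth colour, and what remains has maximum degree 2. -/
theorem IsThreeEdgeConnected.edgeColorable_four (hG : IsCubic G)
    (h3 : IsThreeEdgeConnected G) : EdgeColorable G 4 := by
  classical
  obtain ⟨M, hM⟩ := h3.exists_isPerfectMatching hG
  rw [SimpleGraph.Subgraph.isPerfectMatching_iff] at hM
  obtain ⟨c, hs, hc⟩ := edgeColorable_three_of_ncard_le_two (G := G \ M.spanningCoe) <| by
    intro v
    obtain ⟨w, hw, -⟩ := hM v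
    have h1 : (G \ M.spanningCoe).neighborSet v ⊆ G.neighborSet v \ {w} := by
      rintro x ⟨hx, hx'⟩
      exact ⟨hx, fun e => hx' (Set.mem_singleton_iff.1 e ▸ hw)⟩
    refine (Set.ncard_le_ncard h1 (Set.toFinite _)).trans_eq ?_
    rw [Set.ncard_sdiff_singleton_of_mem (show w ∈ G.neighborSet v from M.adj_sub hw),
      isCubic_iff_ncard.1 hG]
  refine ⟨fun x y => if M.Adj x y then Fin.last 3 else (c x y).castSucc, ?_, ?_⟩
  · intro x y
    simp only [M.adj_comm x y, hs x y]
  · intro v x y hx hy e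
    by_cases h1 : M.Adj v x <;> by_cases h2 : M.Adj v y
    · exact (hM v).unique h1 h2
    · simp only [if_pos h1, if_neg h2] at e
      exact (Fin.castSucc_ne_last _ e.symm).elim
    · simp only [if_neg h1, if_pos h2] at e
      exact (Fin.castSucc_ne_last _ e).elim
    · simp only [if_neg h1, if_neg h2] at e
      exact hc v x y ⟨hx, h1⟩ ⟨hy, h2⟩ (Fin.castSucc_injective _ e)

theorem IsThreeEdgeConnected.isClassTwo [Nonempty V] (hG : IsCubic G)
    (h3 : IsThreeEdgeConnected G) (h : ¬ EdgeColorable G 3) : IsClassTwo G :=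
  hG.isClassTwo_of_edgeColorable h (h3.edgeColorable_four hG)

end Matching

/-! ### Cubic graphs of large girth -/

/-- The Cayley graph of a group with respect to three involutions. -/
def involutionGraph {Γ : Type*} [Group Γ] (s : Fin 3 → Γ) (hs : ∀ i, s i * s i = 1)
    (h1 : ∀ i, s i ≠ 1) : SimpleGraph Γ where
  Adj x y := ∃ i, y = x * s i
  symm.symm x y := by
    rintro ⟨i, rfl⟩
    exact ⟨i, by rw [mul_assoc, hs, mul_one]⟩
  loopless.irrefl x := by
    rintro ⟨i, h⟩
    exact h1 i (left_eq_mul.1 h)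

section Cayley

variable {Γ : Type*} [Group Γ] {s : Fin 3 → Γ} {hs : ∀ i, s i * s i = 1} {h1 : ∀ i, s i ≠ 1}

theorem involutionGraph_neighborSet (x : Γ) :
    (involutionGraph s hs h1).neighborSet x = Set.range fun i => x * s i := by
  ext y
  exact ⟨fun ⟨i, h⟩ => ⟨i, h.symm⟩, fun ⟨i, h⟩ => ⟨i, h.symm⟩⟩

theorem ncard_involutionGraph_neighborSet_inter (hinj : Function.Injective s) (x : Γ)
    (U : Set Γ) :
    ((involutionGraph s hs h1).neighborSet x ∩ U).ncard = {i | x * s i ∈ U}.ncard := by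
  have : (involutionGraph s hs h1).neighborSet x ∩ U =
      (fun i => x * s i) '' {i | x * s i ∈ U} := by
    rw [involutionGraph_neighborSet]
    ext y
    constructor
    · rintro ⟨⟨i, rfl⟩, hy⟩
      exact ⟨i, hy, rfl⟩
    · rintro ⟨i, hy, rfl⟩
      exact ⟨⟨i, rfl⟩, hy⟩
  rw [this, Set.ncard_image_of_injective]
  exact (mul_right_injective x).comp hinj

theorem involutionGraph_isCubic [Fintype Γ] (hinj : Function.Injective s) :
    IsCubic (involutionGraph s hs h1) := by
  rw [isCubic_iff_ncard]
  intro x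
  rw [← Set.inter_univ (SimpleGraph.neighborSet _ x),
    ncard_involutionGraph_neighborSet_inter hinj]
  simp [Set.ncard_univ]

theorem edgeCount_image_mul_left [Finite Γ] (g : Γ) (X Y : Set Γ) :
    edgeCount (involutionGraph s hs h1) ((g * ·) '' X) ((g * ·) '' Y) =
      edgeCount (involutionGraph s hs h1) X Y := by
  have hi : Function.Injective (Prod.map (g * ·) (g * ·) : Γ × Γ → Γ × Γ) :=
    (mul_right_injective g).prodMap (mul_right_injective g)
  refine Eq.trans ?_ (Set.ncard_image_of_injective _ hi)
  rw [edgeCount]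
  congr 1
  ext ⟨x, y⟩
  constructor
  · rintro ⟨⟨x, hx, rfl⟩, ⟨y, hy, rfl⟩, i, e⟩
    exact ⟨(x, y), ⟨hx, hy, i, mul_left_cancel (e.trans (mul_assoc _ _ _))⟩, rfl⟩
  · rintro ⟨⟨x', y'⟩, ⟨hx, hy, i, e⟩, h⟩
    obtain ⟨rfl, rfl⟩ := Prod.mk.inj h
    refine ⟨⟨x', hx, rfl⟩, ⟨y', hy, rfl⟩, i, ?_⟩
    change g * y' = g * x' * s i
    rw [mul_assoc]
    exact congrArg _ e

/-- Submodularity of edge cuts. -/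
theorem edgeCount_inter_add_union_le {V : Type*} [Finite V] {G : SimpleGraph V} (X Y : Set V) :
    edgeCount G (X ∩ Y) (X ∩ Y)ᶜ + edgeCount G (X ∪ Y) (X ∪ Y)ᶜ ≤
      edgeCount G X Xᶜ + edgeCount G Y Yᶜ := by
  have split : ∀ Z : Set V, ∀ P : Set V, edgeCount G Z P =
      edgeCount G (Z ∩ Y) P + edgeCount G (Z \ Y) P := fun Z P => by
    rw [edgeCount_comm, edgeCount_split P Z Y, edgeCount_comm P, edgeCount_comm P]
  have a1 : (X ∩ Y)ᶜ = Xᶜ ∪ (X \ Y) := by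
    ext v; simp only [Set.mem_compl_iff, Set.mem_inter_iff, Set.mem_union, Set.mem_sdiff]; tauto
  have a2 : X ∪ Y = Y ∪ (X \ Y) := by
    ext v; simp only [Set.mem_union, Set.mem_sdiff]; tauto
  have a3 : Yᶜ = (X ∪ Y)ᶜ ∪ (X \ Y) := by
    ext v; simp only [Set.mem_compl_iff, Set.mem_union, Set.mem_sdiff]; tauto
  have d1 : Disjoint Xᶜ (X \ Y) := Set.disjoint_left.2 fun v h h' => h h'.1
  have d2 : Disjoint Y (X \ Y) := Set.disjoint_left.2 fun v h h' => h'.2 h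
  have d3 : Disjoint (X ∪ Y)ᶜ (X \ Y) := Set.disjoint_left.2 fun v h h' => h (.inl h'.1)
  have e1 := split X Xᶜ
  have e2 : edgeCount G (X ∩ Y) (X ∩ Y)ᶜ =
      edgeCount G (X ∩ Y) Xᶜ + edgeCount G (X ∩ Y) (X \ Y) := by
    rw [a1, edgeCount_union_right _ d1]
  have e3 : edgeCount G (X ∪ Y) (X ∪ Y)ᶜ =
      edgeCount G Y (X ∪ Y)ᶜ + edgeCount G (X \ Y) (X ∪ Y)ᶜ := by
    conv_lhs => enter [2]; rw [a2]
    rw [edgeCount_union_left _ d2]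
  have e4 : edgeCount G Y Yᶜ = edgeCount G Y (X ∪ Y)ᶜ + edgeCount G Y (X \ Y) := by
    rw [a3, edgeCount_union_right _ d3]
  have m1 : edgeCount G (X ∩ Y) (X \ Y) ≤ edgeCount G Y (X \ Y) :=
    edgeCount_mono Set.inter_subset_right le_rfl
  have m2 : edgeCount G (X \ Y) (X ∪ Y)ᶜ ≤ edgeCount G (X \ Y) Xᶜ :=
    edgeCount_mono le_rfl (Set.compl_subset_compl.2 Set.subset_union_left)
  omega

/-- Take a minimum cut and, among those, a smallest side `U`, translated to contain 1. Submodularity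
gives xU = U for all x in `U`, so `U` behaves as a subgroup and the cut has b|U| edges, b being the
number of generators outside `U`. Here b ≥ 1 by generation and |U| ≥ 4 - b, so b|U| ≥ 3. -/
theorem involutionGraph_isThreeEdgeConnected [Finite Γ] (hinj : Function.Injective s)
    (hgen : Subgroup.closure (Set.range s) = ⊤) :
    IsThreeEdgeConnected (involutionGraph s hs h1) := by
  classical
  set H := involutionGraph s hs h1
  by_contra hnot
  unfold IsThreeEdgeConnected at hnot
  push Not at hnot
  obtain ⟨X₀, hX₀, hX₀c, hX₀3⟩ := hnot
  let cut : Set Γ → ℕ := fun X => edgeCount H X Xᶜ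
  let P : ℕ → Prop := fun l => ∃ X : Set Γ, X.Nonempty ∧ Xᶜ.Nonempty ∧ cut X = l
  have hP : ∃ l, P l := ⟨_, X₀, hX₀, hX₀c, rfl⟩
  let l := Nat.find hP
  have hmin : ∀ X : Set Γ, X.Nonempty → Xᶜ.Nonempty → l ≤ cut X :=
    fun X h h' => Nat.find_min' hP ⟨X, h, h', rfl⟩
  have hl : l ≤ 2 := (hmin X₀ hX₀ hX₀c).trans (Nat.le_of_lt_succ hX₀3)
  let Q : ℕ → Prop := fun n => ∃ X : Set Γ, X.Nonempty ∧ Xᶜ.Nonempty ∧ cut X = l ∧ X.ncard = n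
  have hQ : ∃ n, Q n := by
    obtain ⟨X, a, b, c⟩ := Nat.find_spec hP
    exact ⟨_, X, a, b, c, rfl⟩
  have hminQ : ∀ X : Set Γ, X.Nonempty → Xᶜ.Nonempty → cut X = l → Nat.find hQ ≤ X.ncard :=
    fun X a b c => Nat.find_min' hQ ⟨X, a, b, c, rfl⟩
  have hcutc : ∀ X, cut Xᶜ = cut X := fun X => by
    change edgeCount H Xᶜ Xᶜᶜ = edgeCount H X Xᶜ
    rw [compl_compl, edgeCount_comm]
  have himg : ∀ (g : Γ) (X : Set Γ), ((g * ·) '' X)ᶜ = (g * ·) '' Xᶜ := fun g X =>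
    (Set.image_compl_eq (Group.mulLeft_bijective g)).symm
  have hcutg : ∀ (g : Γ) (X : Set Γ), cut ((g * ·) '' X) = cut X := fun g X => by
    change edgeCount H _ _ = edgeCount H _ _
    rw [himg, edgeCount_image_mul_left]
  obtain ⟨U, hU1, hUc, hUl, hUn⟩ : ∃ U : Set Γ, 1 ∈ U ∧ Uᶜ.Nonempty ∧ cut U = l ∧
      U.ncard = Nat.find hQ := by
    obtain ⟨X, ⟨x, hx⟩, b, c, d⟩ := Nat.find_spec hQ
    refine ⟨(x⁻¹ * ·) '' X, ⟨x, hx, by simp⟩, ?_, (hcutg _ _).trans c, ?_⟩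
    · rw [himg]
      exact b.image _
    · rw [Set.ncard_image_of_injective _ (mul_right_injective _), d]
  have hUne : U.Nonempty := ⟨1, hU1⟩
  have hhalf : U.ncard ≤ Uᶜ.ncard := by
    rw [hUn]
    exact hminQ _ hUc (by rwa [compl_compl]) ((hcutc U).trans hUl)
  have hmul : ∀ x ∈ U, (x * ·) '' U = U := by
    intro x hx
    set Y := (x * ·) '' U
    have hYn : Y.ncard = U.ncard := Set.ncard_image_of_injective _ (mul_right_injective _)
    have hxY : x ∈ U ∩ Y := ⟨hx, 1, hU1, mul_one x⟩
    have hunion := Set.ncard_union_add_ncard_inter U Y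
    have hint : 0 < (U ∩ Y).ncard := (Set.ncard_pos (Set.toFinite _)).2 ⟨x, hxY⟩
    -- `U` fills at most half of the group and meets `Y`, so the union is proper.
    have hucn : (U ∪ Y)ᶜ.Nonempty := by
      rw [Set.nonempty_compl]
      intro e
      have h2 := Set.ncard_add_ncard_compl U
      rw [e, Set.ncard_univ] at hunion
      omega
    have hicn : (U ∩ Y)ᶜ.Nonempty := hUc.mono (Set.compl_subset_compl.2 Set.inter_subset_left)
    have c1 := hmin _ ⟨x, hxY⟩ hicn
    have c2 := hmin (U ∪ Y) (hUne.mono Set.subset_union_left) hucn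
    have c3 : cut (U ∩ Y) + cut (U ∪ Y) ≤ cut U + cut Y := edgeCount_inter_add_union_le U Y
    have c4 : cut Y = cut U := hcutg x U
    have c5 := hminQ _ ⟨x, hxY⟩ hicn (by omega)
    rw [← hUn] at c5
    have e1 : U ∩ Y = U := Set.eq_of_subset_of_ncard_le Set.inter_subset_left c5
    have e2 : U ⊆ Y := e1 ▸ Set.inter_subset_right
    exact (Set.eq_of_subset_of_ncard_le e2 hYn.le).symm
  have hcount : cut U = {i | s i ∈ Uᶜ}.ncard * U.ncard := by
    refine edgeCount_eq_of_forall fun x hx => ?_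
    rw [ncard_involutionGraph_neighborSet_inter hinj]
    congr 1
    ext i
    simp only [Set.mem_ofPred_eq, Set.mem_compl_iff, not_iff_not]
    conv_lhs => rw [← hmul x hx]
    exact (mul_right_injective x).mem_set_image
  have hout : {i | s i ∈ Uᶜ}.Nonempty := by
    by_contra hempty
    rw [Set.not_nonempty_iff_eq_empty, Set.eq_empty_iff_forall_notMem] at hempty
    have hin : ∀ i, s i ∈ U := fun i => not_not.1 (hempty i)
    obtain ⟨y, hy⟩ := hUc
    refine hy ?_
    have hall : ∀ y ∈ Subgroup.closure (Set.range s), ∀ x ∈ U, x * y ∈ U := by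
      intro y hy
      induction hy using Subgroup.closure_induction with
      | mem y hy =>
        obtain ⟨i, rfl⟩ := hy
        intro x hx
        rw [← hmul x hx]
        exact ⟨s i, hin i, rfl⟩
      | one => simp
      | mul y z _ _ hy hz => exact fun x hx => by rw [← mul_assoc]; exact hz _ (hy x hx)
      | inv y _ hy =>
        intro x hx
        have : Set.image (· * y) U = U := Set.eq_of_subset_of_ncard_le
          (by rintro _ ⟨z, hz, rfl⟩; exact hy z hz)
          (Set.ncard_image_of_injective _ (mul_left_injective y)).ge
        rw [← this] at hx
        obtain ⟨z, hz, rfl⟩ := hx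
        simpa using hz
    simpa using hall y (hgen ▸ Subgroup.mem_top y) 1 hU1
  have hsum : {i | s i ∈ U}.ncard + {i | s i ∈ Uᶜ}.ncard = 3 := by
    have := Set.ncard_add_ncard_compl {i | s i ∈ U}
    rwa [Nat.card_fin] at this
  -- `U` contains 1 besides the generators that lie in it.
  have hle : {i | s i ∈ U}.ncard + 1 ≤ U.ncard := by
    have e : (s '' {i | s i ∈ U}).ncard = {i | s i ∈ U}.ncard :=
      Set.ncard_image_of_injective _ hinj
    rw [← e, ← Set.ncard_insert_of_notMem (a := 1)]
    · refine Set.ncard_le_ncard ?_ (Set.toFinite _)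
      rintro _ (rfl | ⟨i, hi, rfl⟩)
      · exact hU1
      · exact hi
    · rintro ⟨i, -, e⟩
      exact h1 i e
  have hpos := (Set.ncard_pos (Set.toFinite _)).2 hout
  rw [hUl] at hcount
  have : {i | s i ∈ Uᶜ}.ncard * U.ncard ≤ 2 := hcount ▸ hl
  have h3 : {i | s i ∈ Uᶜ}.ncard ≤ 3 := by omega
  generalize {i | s i ∈ Uᶜ}.ncard = b at *
  interval_cases b <;> omega

end Cayley

/-! ### Reduced words and short cycles. -/

section Girth

variable {Γ : Type*} [Group Γ] {s : Fin 3 → Γ} {hs : ∀ i, s i * s i = 1} {h1 : ∀ i, s i ≠ 1}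

/-- A trail in the graph of three involutions spells a reduced word. -/
theorem exists_word_of_isTrail {x y : Γ} (w : (involutionGraph s hs h1).Walk x y)
    (hw : w.IsTrail) : ∃ l : List (Fin 3), l.length = w.length ∧ y = x * (l.map s).prod ∧
      l.IsChain (· ≠ ·) ∧ ∀ i ∈ l.head?, s(x, x * s i) ∈ w.edges := by
  induction w with
  | nil => exact ⟨[], rfl, by simp, List.IsChain.nil, by simp⟩
  | @cons x y z h w ih =>
    rw [SimpleGraph.Walk.isTrail_cons] at hw
    obtain ⟨l, hl, hz, hc, hh⟩ := ih hw.1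
    obtain ⟨i, hi⟩ := id h
    refine ⟨i :: l, by simp [hl], ?_, ?_, ?_⟩
    · rw [hz, hi, List.map_cons, List.prod_cons, mul_assoc]
    · rw [List.isChain_cons]
      refine ⟨?_, hc⟩
      -- A repeated letter would walk back along the edge just used. The clause about the first
      -- letter exists for this comparison.
      rintro j hj rfl
      have := hh i hj
      rw [show y * s i = x by rw [hi, mul_assoc, hs, mul_one], Sym2.eq_swap] at this
      exact hw.2 this
    · intro j hj
      obtain rfl : i = j := by simpa using hj
      rw [← hi]
      simp

theorem le_egirth_involutionGraph {g : ℕ}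
    (hg : ∀ l : List (Fin 3), l.IsChain (· ≠ ·) → l ≠ [] → l.length ≤ g → (l.map s).prod ≠ 1) :
    (g : ℕ∞) ≤ (involutionGraph s hs h1).egirth := by
  rw [SimpleGraph.le_egirth]
  intro x w hw
  obtain ⟨l, hl, hp, hc, -⟩ := exists_word_of_isTrail w hw.isTrail
  by_contra! hlt
  have hlt' : w.length < g := by exact_mod_cast hlt
  refine hg l hc ?_ (by omega) (left_eq_mul.1 hp)
  rintro rfl
  have := hw.three_le_length
  simp at hl
  omega

end Girth

/-- Reduced words of length at most `g` in three letters. -/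
abbrev ReducedWord (g : ℕ) : Type :=
  {l : List (Fin 3) // l.length ≤ g ∧ l.IsChain (· ≠ ·)}

instance (g : ℕ) : Finite (ReducedWord g) :=
  ((List.finite_length_le (Fin 3) g).subset fun _ h => h.1).to_subtype

/-- Multiplication by the letter `i`, where words that would become too long are left alone. -/
def letterStep (g : ℕ) (i : Fin 3) (l : ReducedWord g) : ReducedWord g :=
  if i ∈ l.1.head? then ⟨l.1.tail, by have := l.2.1; simp; omega, l.2.2.tail⟩
  else if h : l.1.length < g ∧ i ∉ l.1.head? then ⟨i :: l.1, by simpa using h.1,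
    List.isChain_cons.2 ⟨fun j hj e => h.2 (e ▸ hj), l.2.2⟩⟩
  else l

theorem letterStep_of_notMem {g : ℕ} {i : Fin 3} {l : ReducedWord g} (h : l.1.length < g)
    (hi : i ∉ l.1.head?) : (letterStep g i l).1 = i :: l.1 := by
  unfold letterStep
  rw [if_neg hi, dif_pos ⟨h, hi⟩]

/-- The map exchanges a word shorter than `g` not starting with `i` and the same word with `i` in
front; words of length `g` not starting with `i` are fixed. -/
theorem letterStep_involutive (g : ℕ) (i : Fin 3) : Function.Involutive (letterStep g i) := by
  rintro ⟨l, hl, hc⟩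
  rcases l with _ | ⟨j, l⟩
  · by_cases hg : 0 < g <;> simp [letterStep, hg]
  · rw [List.isChain_cons] at hc
    rw [List.length_cons] at hl
    by_cases hij : j = i
    · subst hij
      have h2 : j ∉ l.head? := fun h => hc.1 j h rfl
      have h3 : l.length < g := by omega
      have e : letterStep g j ⟨j :: l, hl, List.isChain_cons.2 hc⟩ = ⟨l, by omega, hc.2⟩ := by
        simp [letterStep]
      rw [e]
      exact Subtype.ext (letterStep_of_notMem h3 h2)
    · by_cases hg : l.length + 1 < g
      · have e : letterStep g i ⟨j :: l, hl, List.isChain_cons.2 hc⟩ =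
            ⟨i :: j :: l, by simpa using hg, List.isChain_cons.2
              ⟨by simpa using Ne.symm hij, List.isChain_cons.2 hc⟩⟩ :=
          Subtype.ext (letterStep_of_notMem (by simpa using hg) (by simpa using hij))
        rw [e]
        simp [letterStep]
      · have e : letterStep g i ⟨j :: l, hl, List.isChain_cons.2 hc⟩ =
            ⟨j :: l, hl, List.isChain_cons.2 hc⟩ := by
          simp [letterStep, hij, hg]
        rw [e, e]

/-- The letters are prepended from the last to the first, with neither cancellation nor overflow.
Hence nonempty reduced words of length at most `g` act nontrivially. -/
theorem prod_letterStep_apply_nil {g : ℕ} (l : List (Fin 3)) (hl : l.length ≤ g)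
    (hc : l.IsChain (· ≠ ·)) :
    (l.map fun i => (letterStep_involutive g i).toPerm).prod
      (⟨[], by simp, List.IsChain.nil⟩ : ReducedWord g) = ⟨l, hl, hc⟩ := by
  induction l with
  | nil => rfl
  | cons i l ih =>
    rw [List.isChain_cons] at hc
    rw [List.length_cons] at hl
    rw [List.map_cons, List.prod_cons, Equiv.Perm.mul_apply, ih (by omega) hc.2]
    exact Subtype.ext (letterStep_of_notMem (by simpa using hl) fun h => hc.1 i h rfl)

/-! ### Isomorphic copies on `Fin n` -/

theorem IsCubic.of_iso {V V' : Type*} [Fintype V] [Fintype V'] {G : SimpleGraph V}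
    {G' : SimpleGraph V'} (f : G ≃g G') (h : IsCubic G) : IsCubic G' := by
  rw [isCubic_iff_ncard] at h ⊢
  intro v
  rw [← h (f.symm v), ← Set.ncard_image_of_injective _ f.injective]
  congr 1
  ext y
  simp only [SimpleGraph.mem_neighborSet, Set.mem_image]
  constructor
  · intro hy
    exact ⟨f.symm y, f.symm.map_adj_iff.2 hy, f.apply_symm_apply y⟩
  · rintro ⟨x, hx, rfl⟩
    simpa using f.map_adj_iff.2 hx

theorem IsThreeEdgeConnected.of_iso {V V' : Type*} [Finite V] [Finite V'] {G : SimpleGraph V}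
    {G' : SimpleGraph V'} (f : G ≃g G') (h : IsThreeEdgeConnected G) :
    IsThreeEdgeConnected G' := by
  rintro X ⟨x, hx⟩ ⟨y, hy⟩
  refine (h (f ⁻¹' X) ⟨f.symm x, by simpa using hx⟩ ⟨f.symm y, by simpa using hy⟩).trans ?_
  refine Set.ncard_le_ncard_of_injOn (Prod.map f f) ?_
    (f.injective.prodMap f.injective).injOn (Set.toFinite _)
  rintro ⟨a, b⟩ ⟨ha, hb, hab⟩
  exact ⟨ha, hb, f.map_adj_iff.2 hab⟩

theorem exists_cubic_le_egirth (g : ℕ) : ∃ (Γ : Type) (_ : Fintype Γ) (_ : Nonempty Γ)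
    (A : SimpleGraph Γ), IsCubic A ∧ IsThreeEdgeConnected A ∧ (g : ℕ∞) ≤ A.egirth := by
  classical
  -- Length `g + 2` rather than `g` ensures that words of one and two letters are covered, so that
  -- the generators are nontrivial and distinct for every `g`.
  let t : Fin 3 → Equiv.Perm (ReducedWord (g + 2)) :=
    fun i => (letterStep_involutive (g + 2) i).toPerm
  let K := Subgroup.closure (Set.range t)
  have : Finite K := inferInstance
  let s : Fin 3 → K := fun i => ⟨t i, Subgroup.subset_closure ⟨i, rfl⟩⟩
  have hword : ∀ l : List (Fin 3), l.IsChain (· ≠ ·) → l ≠ [] → l.length ≤ g + 2 →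
      (l.map s).prod ≠ 1 := by
    intro l hc hne hl e
    have e' : (l.map t).prod = 1 := by
      have := congrArg K.subtype e
      rw [map_list_prod, List.map_map, map_one] at this
      exact this
    have h := prod_letterStep_apply_nil l hl hc
    change (l.map t).prod _ = _ at h
    rw [e'] at h
    exact hne (congrArg Subtype.val h).symm
  have hs : ∀ i, s i * s i = 1 := fun i => Subtype.ext <| Equiv.ext fun l =>
    letterStep_involutive (g + 2) i l
  have h1 : ∀ i, s i ≠ 1 := fun i => by
    have := hword [i] (by simp) (by simp) (by simp)
    simpa using this
  have hinj : Function.Injective s := by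
    intro i j hij
    by_contra hne
    refine hword [i, j] (by simpa using hne) (by simp) (by simp) ?_
    simpa [← hij] using hs i
  have hgen : Subgroup.closure (Set.range s) = ⊤ := by
    have : Set.range s = Subtype.val ⁻¹' Set.range t := by
      ext x
      constructor
      · rintro ⟨i, rfl⟩
        exact ⟨i, rfl⟩
      · rintro ⟨i, hi⟩
        exact ⟨i, Subtype.ext hi⟩
    rw [this]
    exact Subgroup.closure_closure_coe_preimage
  have := Fintype.ofFinite K
  refine ⟨K, this, ⟨1⟩, involutionGraph s hs h1, involutionGraph_isCubic hinj,
    involutionGraph_isThreeEdgeConnected hinj hgen, ?_⟩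
  exact le_egirth_involutionGraph fun l hc hne hl => hword l hc hne (by omega)

/-! ### Small graphs -/

theorem isCubic_top_fin_four : IsCubic (⊤ : SimpleGraph (Fin 4)) := by
  rw [isCubic_iff_ncard]
  intro v
  have : (⊤ : SimpleGraph (Fin 4)).neighborSet v = {v}ᶜ := by
    ext w
    simp [eq_comm]
  rw [this, Set.ncard_compl, Nat.card_fin, Set.ncard_singleton]

theorem isThreeEdgeConnected_top_fin_four :
    IsThreeEdgeConnected (⊤ : SimpleGraph (Fin 4)) := by
  intro X hX hXc
  have h1 := (Set.ncard_pos (Set.toFinite _)).2 hX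
  have h2 := (Set.ncard_pos (Set.toFinite _)).2 hXc
  have h3 := Set.ncard_add_ncard_compl X
  rw [Nat.card_fin] at h3
  rw [edgeCount_eq_of_forall (d := Xᶜ.ncard)]
  · rw [show Xᶜ.ncard = 4 - X.ncard by omega]
    have : X.ncard < 4 := by omega
    generalize X.ncard = k at *
    interval_cases k <;> omega
  · intro x hx
    congr 1
    rw [Set.inter_eq_right]
    rintro y hy rfl
    exact hy hx

/-- The smaller side `X` of a cut with at most two edges has 3 to 5 vertices, so some `x` in `X` has
all its neighbours in `X`. These are pairwise nonadjacent, so each has at most |X| - 3 ≤ 2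
neighbours in `X`, and they send at least three edges out of `X`. -/
theorem isThreeEdgeConnected_of_card_le_ten {V : Type*} [Fintype V] {G : SimpleGraph V}
    (hG : IsCubic G) (ht : G.CliqueFree 3) (hV : Fintype.card V ≤ 10) :
    IsThreeEdgeConnected G := by
  classical
  have key : ∀ X : Set V, X.Nonempty → X.ncard ≤ 5 → 3 ≤ edgeCount G X Xᶜ := by
    intro X hX h5
    by_contra! hlt
    have h3 := hG.three_le_ncard hX (by omega)
    obtain ⟨x, hx, hxX⟩ : ∃ x ∈ X, G.neighborSet x ⊆ X := by
      by_contra! hall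
      have : X.ncard ≤ edgeCount G X Xᶜ := by
        refine le_trans (Set.ncard_le_ncard ?_ (Set.toFinite _))
          (Set.ncard_image_le (f := Prod.fst) (Set.toFinite _))
        intro x hx
        obtain ⟨y, hy, hyX⟩ := Set.not_subset.1 (hall x hx)
        exact ⟨(x, y), ⟨hx, hyX, hy⟩, rfl⟩
      omega
    have hN := isCubic_iff_ncard.1 hG x
    have h2 : edgeCount G (G.neighborSet x) X ≤ 2 * (G.neighborSet x).ncard := by
      refine edgeCount_le_of_forall fun y hy => ?_
      have : (X \ G.neighborSet x).ncard ≤ 2 := by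
        have := Set.ncard_sdiff_add_ncard_of_subset hxX (Set.toFinite _)
        omega
      refine le_trans (Set.ncard_le_ncard ?_ (Set.toFinite _)) this
      rintro z ⟨hyz, hz⟩
      refine ⟨hz, fun hxz => ?_⟩
      exact ht {x, y, z} (SimpleGraph.is3Clique_triple_iff.2 ⟨hy, hxz, hyz⟩)
    have h4 := hG.edgeCount_add_compl (G.neighborSet x) X
    have h6 : edgeCount G (G.neighborSet x) Xᶜ ≤ edgeCount G X Xᶜ := edgeCount_mono hxX le_rfl
    omega
  intro X hX hXc
  have hsum := Set.ncard_add_ncard_compl X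
  rw [Nat.card_eq_fintype_card] at hsum
  by_cases h : X.ncard ≤ 5
  · exact key X hX h
  · rw [edgeCount_comm]
    simpa using key Xᶜ hXc (by omega)

/-- The Petersen graph: a pentagon, a pentagram and five spokes. -/
def petersen : SimpleGraph (Fin 5 × Bool) where
  Adj p q := if p.2 = q.2 then
    (p.1 = q.1 + (if p.2 then 1 else 2) ∨ q.1 = p.1 + (if p.2 then 1 else 2)) else p.1 = q.1
  symm.symm := by decide
  loopless.irrefl := by decide

instance : DecidableRel petersen.Adj := fun p q => by
  unfold petersen
  dsimp only
  infer_instance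

theorem petersen_isCubic : IsCubic petersen := by
  have h : petersen.IsRegularOfDegree 3 := by
    intro v
    revert v
    decide
  intro v
  rw [← h v]
  congr!

theorem petersen_cliqueFree : petersen.CliqueFree 3 := by
  intro s hs
  obtain ⟨a, b, c, hab, hac, hbc, -⟩ := SimpleGraph.is3Clique_iff.1 hs
  have : ∀ a b, petersen.Adj a b → ∀ c, petersen.Adj a c → ¬ petersen.Adj b c := by decide
  exact this a b hab c hac hbc

set_option synthInstance.maxSize 2000 in
set_option synthInstance.maxHeartbeats 400000 in
set_option maxRecDepth 20000 in
/-- The fifteen edges of the Petersen graph have no proper colouring with three colours. -/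
theorem petersen_no_coloring : ∀ a0 a1 : Fin 3, a0 ≠ a1 → ∀ s1, s1 ≠ a0 → s1 ≠ a1 →
    ∀ a2, a1 ≠ a2 → ∀ s2, s2 ≠ a1 → s2 ≠ a2 → ∀ a3, a2 ≠ a3 → ∀ s3, s3 ≠ a2 → s3 ≠ a3 →
    ∀ a4, a3 ≠ a4 → a4 ≠ a0 → ∀ s4, s4 ≠ a3 → s4 ≠ a4 → ∀ s0, s0 ≠ a4 → s0 ≠ a0 →
    ∀ b0, b0 ≠ s0 → b0 ≠ s2 → ∀ b2, b2 ≠ s2 → b2 ≠ s4 → b0 ≠ b2 → ∀ b4, b4 ≠ s4 → b4 ≠ s1 →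
    b2 ≠ b4 → ∀ b1, b1 ≠ s1 → b1 ≠ s3 → b4 ≠ b1 → ∀ b3, b3 ≠ s3 → b3 ≠ s0 → b1 ≠ b3 →
    b3 = b0 := by
  decide

theorem petersen_not_edgeColorable : ¬ EdgeColorable petersen 3 := by
  rintro ⟨c, hs, hc⟩
  have ne : ∀ v x y, petersen.Adj v x → petersen.Adj v y → x ≠ y → c x v ≠ c v y :=
    fun v x y hx hy hne e => hne (hc v x y hx hy ((hs v x).trans e))
  have ne' : ∀ v x y, petersen.Adj v x → petersen.Adj v y → x ≠ y → c v x ≠ c y v :=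
    fun v x y hx hy hne e => hne (hc v x y hx hy (e.trans (hs y v)))
  have ne'' : ∀ v x y, petersen.Adj v x → petersen.Adj v y → x ≠ y → c v x ≠ c v y :=
    fun v x y hx hy hne e => hne (hc v x y hx hy e)
  have ne3 : ∀ v x y, petersen.Adj v x → petersen.Adj v y → x ≠ y → c x v ≠ c y v :=
    fun v x y hx hy hne e => hne (hc v x y hx hy ((hs v x).trans (e.trans (hs y v))))
  let o : Fin 5 → Fin 5 × Bool := fun i => (i, true)
  let n : Fin 5 → Fin 5 × Bool := fun i => (i, false)
  refine ne (n 0) (n 3) (n 2) (by decide) (by decide) (by decide) ?_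
  apply petersen_no_coloring
    (c (o 0) (o 1)) (c (o 1) (o 2)) ?_ (c (o 1) (n 1)) ?_ ?_ (c (o 2) (o 3)) ?_
    (c (o 2) (n 2)) ?_ ?_ (c (o 3) (o 4)) ?_ (c (o 3) (n 3)) ?_ ?_ (c (o 4) (o 0)) ?_ ?_
    (c (o 4) (n 4)) ?_ ?_ (c (o 0) (n 0)) ?_ ?_ (c (n 0) (n 2)) ?_ ?_ (c (n 2) (n 4)) ?_ ?_ ?_
    (c (n 4) (n 1)) ?_ ?_ ?_ (c (n 1) (n 3)) ?_ ?_ ?_ (c (n 3) (n 0)) ?_ ?_ ?_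
  all_goals
    first
      | exact ne _ _ _ (by decide) (by decide) (by decide)
      | exact ne' _ _ _ (by decide) (by decide) (by decide)
      | exact ne'' _ _ _ (by decide) (by decide) (by decide)
      | exact ne3 _ _ _ (by decide) (by decide) (by decide)

/-! ### The graphs with large excess -/

theorem exists_neighborSet_equiv {V W : Type*} [Fintype V] [Fintype W] {G : SimpleGraph V}
    {A : SimpleGraph W} (hG : IsCubic G) (hA : IsCubic A) (a : W) :
    Nonempty (∀ v : V, G.neighborSet v ≃ A.neighborSet a) := by
  refine ⟨fun v => (Finite.card_eq.1 ?_).some⟩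
  rw [Nat.card_coe_set_eq, Nat.card_coe_set_eq, isCubic_iff_ncard.1 hG,
    isCubic_iff_ncard.1 hA]

/-- The properties of `K₄ ∘ A⁻`, transported to `Fin (4 * (p - 1))`. -/
theorem exists_top_circMinus {W : Type*} [Fintype W] [Nonempty W] {A : SimpleGraph W}
    (hA : IsCubic A) (hA3 : IsThreeEdgeConnected A) :
    ∃ A' : SimpleGraph (Fin (4 * (Fintype.card W - 1))), IsCubic A' ∧ IsThreeEdgeConnected A' ∧
      A.egirth ≤ A'.egirth ∧ (EdgeColorable A' 3 → EdgeColorable A 3) := by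
  classical
  have a := Classical.arbitrary W
  obtain ⟨φ⟩ := exists_neighborSet_equiv isCubic_top_fin_four hA a
  have hcard : Fintype.card (Fin 4 × {x : W // x ≠ a}) = 4 * (Fintype.card W - 1) := by
    rw [card_circMinus, Fintype.card_fin]
  have f := (circMinus ⊤ A a φ).overFinIso hcard
  refine ⟨_, (circMinus_isCubic hA).of_iso f,
    (circMinus_isThreeEdgeConnected isCubic_top_fin_four hA
      isThreeEdgeConnected_top_fin_four hA3).of_iso f,
    egirth_le_egirth_circMinus.trans f.egirth_eq.le, fun h => ?_⟩
  exact ((h.of_iso f).of_circMinus isCubic_top_fin_four hA).2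

/-- Passing from `G` of order n to K₄ ∘ `G⁻` raises the order to 4(n - 1) > n. -/
theorem exists_cubic_le_card (N : ℕ) : ∃ n, N ≤ n ∧ ∃ G : SimpleGraph (Fin n),
    0 < n ∧ IsCubic G ∧ IsThreeEdgeConnected G := by
  induction N with
  | zero => exact ⟨4, by omega, ⊤, by omega, isCubic_top_fin_four,
      isThreeEdgeConnected_top_fin_four⟩
  | succ N ih =>
    obtain ⟨n, hn, G, hpos, hG, hG3⟩ := ih
    have : NeZero n := ⟨hpos.ne'⟩
    have h4 := hG.four_le_card 0
    obtain ⟨G', hG', hG3', -⟩ := exists_top_circMinus hG hG3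
    rw [Fintype.card_fin] at h4
    exact ⟨_, by rw [Fintype.card_fin]; omega, G', by rw [Fintype.card_fin]; omega, hG', hG3'⟩

/-- The common source of both existence statements: `A'` is K₄ ∘ `A⁻`, whose order is divisible by 4
as the count in the copies needs. -/
theorem exists_circMinus_le_excess {W : Type*} [Fintype W] [Nonempty W] {A : SimpleGraph W}
    (hA : IsCubic A) (hA3 : IsThreeEdgeConnected A) (m : ℕ) :
    ∃ (n p : ℕ) (G : SimpleGraph (Fin n)) (A' : SimpleGraph (Fin p)) (a : Fin p)
      (φ : ∀ v : Fin n, G.neighborSet v ≃ A'.neighborSet a),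
      0 < n ∧ IsCubic G ∧ IsThreeEdgeConnected G ∧ IsCubic A' ∧ IsThreeEdgeConnected A' ∧
      A.egirth ≤ A'.egirth ∧ (EdgeColorable A' 3 → EdgeColorable A 3) ∧
      (m : ℤ) ≤ excess (circMinus G A' a φ) := by
  obtain ⟨n, hn, G, hpos, hG, hG3⟩ := exists_cubic_le_card (4 * m + 2)
  obtain ⟨A', hA', hA3', hg, hc⟩ := exists_top_circMinus hA hA3
  have h4 := hA.four_le_card (Classical.arbitrary W)
  let a : Fin (4 * (Fintype.card W - 1)) := ⟨0, by omega⟩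
  obtain ⟨φ⟩ := exists_neighborSet_equiv hG hA' a
  refine ⟨n, _, G, A', a, φ, hpos, hG, hG3, hA', hA3', hg, hc, ?_⟩
  exact le_excess_circMinus hG hA' (by simp) (by simpa using hn)

/-! ### Gardner snarks -/

theorem circMinus_isGardnerSnark {V W : Type*} [Fintype V] [Nonempty V] [Fintype W]
    [DecidableEq W] {G : SimpleGraph V} {A : SimpleGraph W} {a : W}
    {φ : ∀ v : V, G.neighborSet v ≃ A.neighborSet a} (hG : IsCubic G)
    (hG3 : IsThreeEdgeConnected G) (hA : IsCubic A) (hA3 : IsThreeEdgeConnected A)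
    (hg : 4 ≤ A.egirth) (hc : ¬ EdgeColorable A 3) : IsGardnerSnark (circMinus G A a φ) := by
  have hne : Nonempty {x : W // x ≠ a} := by
    rw [← Fintype.card_pos_iff, Fintype.card_subtype_compl, Fintype.card_subtype_eq]
    have := hA.four_le_card a
    omega
  have hH := circMinus_isCubic (G := G) (φ := φ) hA
  have hH3 := circMinus_isThreeEdgeConnected (φ := φ) hG hA hG3 hA3
  exact ⟨hH, hH3.connected, fun _ he => hH3.not_isBridge he,
    cliqueFree_three_of_four_le_egirth (hg.trans egirth_le_egirth_circMinus),
    hH3.isClassTwo hH fun h => hc (h.of_circMinus hG hA).2⟩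

theorem circMinus_isVertexConnected {V W : Type*} [Fintype V] [Nonempty V] [Fintype W]
    [DecidableEq W] {G : SimpleGraph V} {A : SimpleGraph W} {a : W}
    {φ : ∀ v : V, G.neighborSet v ≃ A.neighborSet a} (hG : IsCubic G)
    (hG3 : IsThreeEdgeConnected G) (hA : IsCubic A) (hA3 : IsThreeEdgeConnected A) :
    IsVertexConnected (circMinus G A a φ) 3 := by
  have hne : Nonempty {x : W // x ≠ a} := by
    rw [← Fintype.card_pos_iff, Fintype.card_subtype_compl, Fintype.card_subtype_eq]
    have := hA.four_le_card a
    omega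
  exact (circMinus_isThreeEdgeConnected hG hA hG3 hA3).isVertexConnected (circMinus_isCubic hA)

/-! ### The main theorem. -/

theorem mainTheorem1 :
    -- existence, for every girth and every excess
    (∀ g : ℕ, 3 ≤ g → ∀ m : ℕ,
      ∃ (n p : ℕ) (G : SimpleGraph (Fin n)) (A : SimpleGraph (Fin p)) (a : Fin p)
        (φ : ∀ v : Fin n, G.neighborSet v ≃ A.neighborSet a),
        IsCubic G ∧ IsCubic A ∧
        IsCubic (circMinus G A a φ) ∧
        IsVertexConnected (circMinus G A a φ) 3 ∧
        (g : ℕ∞) ≤ (circMinus G A a φ).egirth ∧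
        (m : ℤ) ≤ excess (circMinus G A a φ)) ∧
    -- chromatic index of every graph of the form `G ∘ A⁻`
    (∀ (V W : Type*) [Fintype V] [Nonempty V] [Fintype W] [DecidableEq W]
      (G : SimpleGraph V) (A : SimpleGraph W) (a : W)
      (φ : ∀ v : V, G.neighborSet v ≃ A.neighborSet a),
      IsCubic G → IsCubic A →
      (IsClassOne (circMinus G A a φ) ↔ IsClassOne G ∧ IsClassOne A)) ∧
    -- every choice of `A` of Class 2 in the construction gives Gardner snarks
    (∀ (V W : Type*) [Fintype V] [Fintype W] [DecidableEq W]
      (G : SimpleGraph V) (A : SimpleGraph W) (a : W)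
      (φ : ∀ v : V, G.neighborSet v ≃ A.neighborSet a) (m : ℕ),
      IsCubic G → IsVertexConnected G 3 → 4 * m + 2 ≤ Fintype.card V →
      IsCubic A → IsVertexConnected A 3 → 4 ∣ Fintype.card W → 4 ≤ A.egirth → IsClassTwo A →
      IsGardnerSnark (circMinus G A a φ) ∧ (m : ℤ) ≤ excess (circMinus G A a φ)) ∧
    -- such choices exist, with arbitrarily large excess
    (∀ m : ℕ,
      ∃ (n p : ℕ) (G : SimpleGraph (Fin n)) (A : SimpleGraph (Fin p)) (a : Fin p)
        (φ : ∀ v : Fin n, G.neighborSet v ≃ A.neighborSet a),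
        IsCubic G ∧ IsCubic A ∧ IsClassTwo A ∧
        IsVertexConnected (circMinus G A a φ) 3 ∧
        IsGardnerSnark (circMinus G A a φ) ∧
        (m : ℤ) ≤ excess (circMinus G A a φ)) := by
  refine ⟨?_, ?_, ?_, ?_⟩
  · intro g _ m
    obtain ⟨Γ, _, _, A, hA, hA3, hg⟩ := exists_cubic_le_egirth g
    obtain ⟨n, p, G, A', a, φ, hpos, hG, hG3, hA', hA3', hg', -, hm⟩ :=
      exists_circMinus_le_excess hA hA3 m
    have : NeZero n := ⟨hpos.ne'⟩
    exact ⟨n, p, G, A', a, φ, hG, hA', circMinus_isCubic hA',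
      circMinus_isVertexConnected hG hG3 hA' hA3',
      hg.trans (hg'.trans egirth_le_egirth_circMinus), hm⟩
  · intro V W _ _ _ _ G A a φ hG hA
    have hne : Nonempty {x : W // x ≠ a} := by
      rw [← Fintype.card_pos_iff, Fintype.card_subtype_compl, Fintype.card_subtype_eq]
      have := hA.four_le_card a
      omega
    have : Nonempty W := ⟨a⟩
    rw [(circMinus_isCubic hA).isClassOne_iff, hG.isClassOne_iff, hA.isClassOne_iff]
    exact ⟨fun h => h.of_circMinus hG hA, fun h => edgeColorable_circMinus hG h.1 h.2⟩
  · intro V W _ _ _ G A a φ m hG hGc hcard hA hAc h4 hg h2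
    have : Nonempty W := ⟨a⟩
    have : Nonempty V := Fintype.card_pos_iff.1 (by omega)
    exact ⟨circMinus_isGardnerSnark hG (hGc.isThreeEdgeConnected hG) hA
      (hAc.isThreeEdgeConnected hA) hg (hA.not_edgeColorable_of_isClassTwo h2),
      le_excess_circMinus hG hA h4 hcard⟩
  · intro m
    obtain ⟨n, p, G, A, a, φ, hpos, hG, hG3, hA, hA3, hg, hc, hm⟩ :=
      exists_circMinus_le_excess petersen_isCubic
        (isThreeEdgeConnected_of_card_le_ten petersen_isCubic petersen_cliqueFree (by decide)) m
    have : NeZero n := ⟨hpos.ne'⟩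
    have : Nonempty (Fin p) := ⟨a⟩
    have hcA : ¬ EdgeColorable A 3 := fun h => petersen_not_edgeColorable (hc h)
    exact ⟨n, p, G, A, a, φ, hG, hA, hA3.isClassTwo hA hcA,
      circMinus_isVertexConnected hG hG3 hA hA3,
      circMinus_isGardnerSnark hG hG3 hA hA3
        ((four_le_egirth_of_cliqueFree_three petersen_cliqueFree).trans hg) hcA, hm⟩
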